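/- For a finite simple undirected graph $G=(V,E)$ with edge costs $c:E\to\mathbb{Q}_{\ge 0}$ and an edge set $J\subseteq E$, let $\delta_J(v)$ be the set of edges of $J$ incident to $v$. The power of a node $v$ in $J$ is $p_J(v)=\max_{e\in\delta_J(v)}c(e)$ if $\delta_J(v)\neq\emptyset$, and $p_J(v)=0$ otherwise; the power of $J$ is $p_J(V)=\sum_{v\in V}p_J(v)$. Given degree bounds $r(v)\in\mathbb{Z}_{\ge 0}$ for $v\in V$, an $r$-edge cover is a set $J\subseteq E$ with $|\delta_J(v)|\ge r(v)$ for every $v\in V$. Minimum-Power Edge-Multi-Cover is the problem of finding, for given $G$, $c$, $r$, an $r$-edge cover $J\subseteq E$ of minimum power. Let $k=\max_{v\in V}r(v)$. Theorem. Minimum-Power Edge-Multi-Cover admits a polynomial-time $(k+\frac12)$-approximation algorithm: there is one algorithm that, on every instance $(G,c,r)$, halts after a number of steps that is at most a fixed polynomial in the number of bits of the instance, and that, whenever the instance has an $r$-edge cover, outputs an $r$-edge cover $J\subseteq E$ with $$p_J(V)\le\left(k+\tfrac12\right)\cdot\min\{p_{J'}(V): J'\subseteq E \text{ is an } r\text{-edge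 cover}\}.$$ -/

import Mathlib

/-!
A random access machine with natural-number words and a structured instruction set.
It has finitely many registers and finitely many arrays in any given program.  Every evaluated
operation of an expression and every executed instruction is charged one unit of time.
The only arithmetic is addition, truncated subtraction and halving, so that one operation increases
the bit length of the largest word by at most one; hence polynomially many steps on this machine are
the same as polynomial time on a Turing machine (there is no multiplication at unit cost).
-/

namespace RAM

/-- The memory: registers `reg x` and arrays `arr a`, with cells `arr a i`. -/
structure State where
  reg : ℕ → ℕ
  arr : ℕ → ℕ → ℕ

/-- Expressions.  Register names, array names and literals are constants of the program;
array cells are addressed by computed values. -/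
inductive Expr where
  | lit (c : ℕ)
  | reg (x : ℕ)
  | get (a : ℕ) (i : Expr)
  | add (e f : Expr)
  | sub (e f : Expr)
  | half (e : Expr)

/-- The value of an expression. -/
def Expr.eval (s : State) : Expr → ℕ
  | .lit c => c
  | .reg x => s.reg x
  | .get a i => s.arr a (i.eval s)
  | .add e f => e.eval s + f.eval s
  | .sub e f => e.eval s - f.eval s
  | .half e => e.eval s / 2

/-- The time charged for evaluating an expression: one unit for each of its operations. -/
def Expr.time : Expr → ℕ
  | .lit _ => 1
  | .reg _ => 1
  | .get _ i => i.time + 1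
  | .add e f => e.time + f.time + 1
  | .sub e f => e.time + f.time + 1
  | .half e => e.time + 1

/-- Programs.  A test `e` counts as true if its value is not zero. -/
inductive Program where
  | noop
  | assign (x : ℕ) (e : Expr)
  | store (a : ℕ) (i e : Expr)
  | seq (P Q : Program)
  | ite (e : Expr) (P Q : Program)
  | loop (e : Expr) (P : Program)

/-- `s` with register `x` set to `w`. -/
def State.setReg (s : State) (x w : ℕ) : State :=
  { s with reg := Function.update s.reg x w }

/-- `s` with cell `i` of array `a` set to `w`. -/
def State.setArr (s : State) (a i w : ℕ) : State :=
  { s with arr := Function.update s.arr a (Function.update (s.arr a) i w) }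

/-- `Exec P s s' t`: started in memory `s`, the program `P` halts after exactly `t` units of time,
with memory `s'`. -/
inductive Exec : Program → State → State → ℕ → Prop where
  | noop (s : State) : Exec .noop s s 1
  | assign (x : ℕ) (e : Expr) (s : State) :
      Exec (.assign x e) s (s.setReg x (e.eval s)) (e.time + 1)
  | store (a : ℕ) (i e : Expr) (s : State) :
      Exec (.store a i e) s (s.setArr a (i.eval s) (e.eval s)) (i.time + e.time + 1)
  | seq {P Q : Program} {s s' s'' : State} {t t' : ℕ} :
      Exec P s s' t → Exec Q s' s'' t' → Exec (.seq P Q) s s'' (t + t' + 1)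
  | ite_true {e : Expr} {P Q : Program} {s s' : State} {t : ℕ} :
      e.eval s ≠ 0 → Exec P s s' t → Exec (.ite e P Q) s s' (e.time + t + 1)
  | ite_false {e : Expr} {P Q : Program} {s s' : State} {t : ℕ} :
      e.eval s = 0 → Exec Q s s' t → Exec (.ite e P Q) s s' (e.time + t + 1)
  | loop_true {e : Expr} {P : Program} {s s' s'' : State} {t t' : ℕ} :
      e.eval s ≠ 0 → Exec P s s' t → Exec (.loop e P) s' s'' t' →
        Exec (.loop e P) s s'' (e.time + t + t' + 1)
  | loop_false {e : Expr} {P : Program} {s : State} :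
      e.eval s = 0 → Exec (.loop e P) s s (e.time + 1)

end RAM

noncomputable section

/-- An instance of Minimum-Power Edge-Multi-Cover: a simple graph on `Fin n`, nonnegative rational
edge costs (the values of `cost` off the edges are never used) and degree bounds. -/
structure MPEMC where
  n : ℕ
  graph : SimpleGraph (Fin n)
  cost : Sym2 (Fin n) → ℚ≥0
  req : Fin n → ℕ

namespace MPEMC

/-- The set `δ_J(v)` of edges of `J` that are incident to `v`. -/
def incident {n : ℕ} (J : Finset (Sym2 (Fin n))) (v : Fin n) : Finset (Sym2 (Fin n)) :=
  J.filter (fun e => v ∈ e)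

/-- The power of a node: the largest cost of an edge of `J` incident to `v`, and `0` if there is
none (the supremum of the empty set in `ℚ≥0`). -/
def nodePower (I : MPEMC) (J : Finset (Sym2 (Fin I.n))) (v : Fin I.n) : ℚ≥0 :=
  (incident J v).sup I.cost

/-- The power of the subgraph with edge set `J`. -/
def power (I : MPEMC) (J : Finset (Sym2 (Fin I.n))) : ℚ≥0 :=
  ∑ v, I.nodePower J v

/-- `J` is a feasible solution: a set of edges of the graph that has degree at least `r(v)` at every
node `v`. -/
def IsCover (I : MPEMC) (J : Finset (Sym2 (Fin I.n))) : Prop :=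
  (∀ e ∈ J, e ∈ I.graph.edgeSet) ∧ ∀ v, I.req v ≤ (incident J v).card

/-- The maximum degree bound `k`. -/
def maxReq (I : MPEMC) : ℕ := Finset.univ.sup I.req

open Classical in
/-- Entry `(i, j)` of the matrix of cost numerators (`0` for non-adjacent pairs). -/
def num (I : MPEMC) (i j : Fin I.n) : ℕ :=
  if I.graph.Adj i j then (I.cost s(i, j)).num else 0

open Classical in
/-- Entry `(i, j)` of the matrix of cost denominators; `0` marks the non-adjacent pairs. -/
def den (I : MPEMC) (i j : Fin I.n) : ℕ :=
  if I.graph.Adj i j then (I.cost s(i, j)).den else 0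

/-- An `n × n` matrix as an array: entry `(i, j)` is in cell `i * n + j`. -/
def rowMajor {n : ℕ} (M : Fin n → Fin n → ℕ) (m : ℕ) : ℕ :=
  if h : m < n * n then
    M (finProdFinEquiv.symm ⟨m, h⟩).1 (finProdFinEquiv.symm ⟨m, h⟩).2
  else 0

/-- The memory that holds the input: `n` in register `0`, the degree bounds in array `0`, the
numerators and denominators of the costs in arrays `1` and `2`, and `0` everywhere else. -/
def input (I : MPEMC) : RAM.State where
  reg x := if x = 0 then I.n else 0
  arr a m :=
    if a = 0 then (if h : m < I.n then I.req ⟨m, h⟩ else 0)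
    else if a = 1 then rowMajor I.num m
    else if a = 2 then rowMajor I.den m
    else 0

/-- The number of bits of the input: the sum over all input words of their binary lengths, plus
one for each word. -/
def size (I : MPEMC) : ℕ :=
  (I.n.size + 1) + ∑ v, ((I.req v).size + 1) +
    ∑ i, ∑ j, (((I.num i j).size + 1) + ((I.den i j).size + 1))

/-- The edge set that is read off the memory at the end: the pairs `ij` such that cell
`i * n + j` of array `3` is not zero. -/
def output (I : MPEMC) (s : RAM.State) : Finset (Sym2 (Fin I.n)) :=
  (Finset.univ.filter (fun q : Fin I.n × Fin I.n => s.arr 3 (q.1 * I.n + q.2) ≠ 0)).image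
    (fun q => s(q.1, q.2))

end MPEMC

end

/-! Let w(v) (`weight`) be the cost of the r(v)-th cheapest edge at v, with ties broken by index.
Every cover gives v power at least w(v) (`Feasible.weight_le`). If each node buys its r(v) cheapest
edges and every other endpoint pays for the edges it receives, the total is at most (k+1) Σw. The
half is saved by letting a node buy only r(v)-1 edges whenever its last edge can be supplied more
cheaply by a star.

A node counts as covered once it has a selected edge that is not among its r(v)-1 cheapest
(`Outside`). One greedy pass selects stars whose increase of power above w is less than half of the
weight they newly cover. Covered nodes then buy r(v)-1 edges, the others r(v). If U is the uncovered
weight, twice the power is at most (2k+1) Σw + U (`Progress.exists_budget`).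

It remains to bound U. After the pass no profitable star is left (`NoStar`). A cover with node
powers P contains, by `Feasible.exists_stars`, stars that reach all uncovered nodes with positive
degree bound and whose increases above w add up to at most Σ(P-w). Each star covers at most twice
its increase, so U ≤ 2 Σ(P-w) (`Feasible.sum_uncovered_le`). For k ≥ 1 this gives (2k+1) Σw + 2
Σ(P-w) ≤ (2k+1) ΣP.

On the machine, costs are multiplied by the product of all denominators to become natural numbers of
polynomial length. Each loop makes a number of iterations bounded by the input size, so the
polynomial `Program.cost` bounds the time. -/

namespace RAM

/-! ### Program logic: frames and total correctness with time bounds. -/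

@[simp] theorem State.setReg_reg (s : State) (x w y : ℕ) :
    (s.setReg x w).reg y = if y = x then w else s.reg y := by
  simp [State.setReg, Function.update_apply]

@[simp] theorem State.setReg_arr (s : State) (x w : ℕ) : (s.setReg x w).arr = s.arr := rfl

@[simp] theorem State.setArr_reg (s : State) (a i w : ℕ) : (s.setArr a i w).reg = s.reg := rfl

@[simp] theorem State.setArr_arr (s : State) (a i w b : ℕ) :
    (s.setArr a i w).arr b = if b = a then Function.update (s.arr a) i w else s.arr b := by
  simp [State.setArr, Function.update_apply]

namespace Expr

/-- Logical negation of a test. -/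
def not (e : Expr) : Expr := .sub (.lit 1) e

/-- Logical conjunction of two tests. -/
def and (e f : Expr) : Expr := not (.add (not e) (not f))

/-- The test `e < f`. -/
def lt (e f : Expr) : Expr := .sub f e

/-- The test `e ≠ f`. -/
def ne (e f : Expr) : Expr := .add (.sub e f) (.sub f e)

variable (s : State) (e f : Expr)

@[simp] theorem eval_not : (not e).eval s = 0 ↔ e.eval s ≠ 0 := by
  simp only [not, eval]; omega

@[simp] theorem eval_and : (and e f).eval s = 0 ↔ ¬ (e.eval s ≠ 0 ∧ f.eval s ≠ 0) := by
  simp only [and, not, eval]; omega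

@[simp] theorem eval_lt : (lt e f).eval s = 0 ↔ ¬ e.eval s < f.eval s := by
  simp only [lt, eval]; omega

@[simp] theorem eval_ne : (ne e f).eval s = 0 ↔ e.eval s = f.eval s := by
  simp only [ne, eval]; omega

end Expr

namespace Program

/-- Whether some instruction of the program assigns to register `x`. -/
def writesReg (x : ℕ) : Program → Bool
  | .noop => false
  | .assign y _ => x == y
  | .store _ _ _ => false
  | .seq P Q => P.writesReg x || Q.writesReg x
  | .ite _ P Q => P.writesReg x || Q.writesReg x
  | .loop _ P => P.writesReg x

/-- Whether some instruction of the program stores into array `a`. -/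
def writesArr (a : ℕ) : Program → Bool
  | .noop => false
  | .assign _ _ => false
  | .store b _ _ => a == b
  | .seq P Q => P.writesArr a || Q.writesArr a
  | .ite _ P Q => P.writesArr a || Q.writesArr a
  | .loop _ P => P.writesArr a

/-- A bound for the running time, as a polynomial in a bound for the number of iterations of each
execution of a loop. -/
noncomputable def cost : Program → Polynomial ℕ
  | .noop => 1
  | .assign _ e => (e.time + 1 : ℕ)
  | .store _ i e => (i.time + e.time + 1 : ℕ)
  | .seq P Q => P.cost + Q.cost + 1
  | .ite e P Q => (e.time : Polynomial ℕ) + (P.cost + Q.cost) + 1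
  | .loop e P => (Polynomial.X + 1) * ((e.time : Polynomial ℕ) + P.cost + 1)

end Program

/-- Two memories agree outside of the registers and arrays that the program `P` writes. -/
def Frame (P : Program) (s s' : State) : Prop :=
  (∀ x, P.writesReg x = false → s'.reg x = s.reg x) ∧
    ∀ a, P.writesArr a = false → s'.arr a = s.arr a

theorem Exec.frame {P : Program} {s s' : State} {t : ℕ} (h : Exec P s s' t) : Frame P s s' := by
  induction h with
  | noop s => exact ⟨fun _ _ => rfl, fun _ _ => rfl⟩
  | assign x e s =>
    refine ⟨fun y hy => ?_, fun _ _ => rfl⟩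
    simp_all [Program.writesReg]
  | store a i e s =>
    refine ⟨fun _ _ => rfl, fun b hb => ?_⟩
    simp_all [Program.writesArr]
  | seq h₁ h₂ ih₁ ih₂ =>
    refine ⟨fun x hx => ?_, fun a ha => ?_⟩
    · simp only [Program.writesReg, Bool.or_eq_false_iff] at hx
      rw [ih₂.1 x hx.2, ih₁.1 x hx.1]
    · simp only [Program.writesArr, Bool.or_eq_false_iff] at ha
      rw [ih₂.2 a ha.2, ih₁.2 a ha.1]
  | ite_true he h ih =>
    refine ⟨fun x hx => ?_, fun a ha => ?_⟩
    · simp only [Program.writesReg, Bool.or_eq_false_iff] at hx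
      exact ih.1 x hx.1
    · simp only [Program.writesArr, Bool.or_eq_false_iff] at ha
      exact ih.2 a ha.1
  | ite_false he h ih =>
    refine ⟨fun x hx => ?_, fun a ha => ?_⟩
    · simp only [Program.writesReg, Bool.or_eq_false_iff] at hx
      exact ih.1 x hx.2
    · simp only [Program.writesArr, Bool.or_eq_false_iff] at ha
      exact ih.2 a ha.2
  | loop_true he h₁ h₂ ih₁ ih₂ =>
    refine ⟨fun x hx => ?_, fun a ha => ?_⟩
    · rw [ih₂.1 x hx, ih₁.1 x (by simpa [Program.writesReg] using hx)]
    · rw [ih₂.2 a ha, ih₁.2 a (by simpa [Program.writesArr] using ha)]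
  | loop_false he => exact ⟨fun _ _ => rfl, fun _ _ => rfl⟩

/-- Total correctness with a time bound: `P` started in `s` halts within the time `P.cost`,
evaluated at `M`, in a memory that satisfies `Q`. -/
def Runs (M : ℕ) (P : Program) (s : State) (Q : State → Prop) : Prop :=
  ∃ s' t, Exec P s s' t ∧ t ≤ P.cost.eval M ∧ Q s'

namespace Runs

variable {M : ℕ} {P P' : Program} {s : State} {Q Q' : State → Prop}

/-- The frame passed to the continuation keeps invariants short: that `P` preserves a register or an
array is settled by evaluating `writesReg` or `writesArr`, usually by `rfl`. -/
theorem mono (h : Runs M P s Q) (hQ : ∀ s', Frame P s s' → Q s' → Q' s') : Runs M P s Q' := by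
  obtain ⟨s', t, h₁, h₂, h₃⟩ := h
  exact ⟨s', t, h₁, h₂, hQ s' h₁.frame h₃⟩

theorem noop (h : Q s) : Runs M .noop s Q :=
  ⟨s, 1, .noop s, by simp [Program.cost], h⟩

theorem assign {x : ℕ} {e : Expr} (h : Q (s.setReg x (e.eval s))) : Runs M (.assign x e) s Q :=
  ⟨_, _, .assign x e s, by simp [Program.cost], h⟩

theorem store {a : ℕ} {i e : Expr} (h : Q (s.setArr a (i.eval s) (e.eval s))) :
    Runs M (.store a i e) s Q :=
  ⟨_, _, .store a i e s, by simp [Program.cost], h⟩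

theorem seq (h : Runs M P s (fun s' => Runs M P' s' Q)) : Runs M (.seq P P') s Q := by
  obtain ⟨s', t, h₁, h₂, s'', t', h₃, h₄, h₅⟩ := h
  exact ⟨s'', _, .seq h₁ h₃, by simp [Program.cost]; omega, h₅⟩

theorem ite {e : Expr} (h₁ : e.eval s ≠ 0 → Runs M P s Q) (h₂ : e.eval s = 0 → Runs M P' s Q) :
    Runs M (.ite e P P') s Q := by
  by_cases he : e.eval s = 0
  · obtain ⟨s', t, h₁, h₂, h₃⟩ := h₂ he
    exact ⟨s', _, .ite_false he h₁, by simp [Program.cost]; omega, h₃⟩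
  · obtain ⟨s', t, h₁, h₂, h₃⟩ := h₁ he
    exact ⟨s', _, .ite_true he h₁, by simp [Program.cost]; omega, h₃⟩

/-- Induction on the number of remaining iterations. With `k` iterations the test is evaluated `k +
1` times, whence the factor `X + 1` in `Program.cost`. Frames refer to the memory before the whole
loop. -/
theorem loop {e : Expr} {k : ℕ} (hk : k ≤ M) (Inv : ℕ → State → Prop) (h₀ : Inv 0 s)
    (step : ∀ i < k, ∀ s', Frame (.loop e P) s s' → Inv i s' →
      e.eval s' ≠ 0 ∧ Runs M P s' (Inv (i + 1)))
    (halt : ∀ s', Frame (.loop e P) s s' → Inv k s' → e.eval s' = 0) :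
    Runs M (.loop e P) s (Inv k) := by
  have key : ∀ j ≤ k, ∀ s', Frame (.loop e P) s s' → Inv (k - j) s' →
      ∃ s'' t, Exec (.loop e P) s' s'' t ∧
        t ≤ (j + 1) * (e.time + P.cost.eval M + 1) ∧ Inv k s'' := by
    intro j
    induction j with
    | zero =>
      intro _ s' hf hs'
      exact ⟨s', _, .loop_false (halt s' hf hs'), by omega, hs'⟩
    | succ j ih =>
      intro hj s' hf hs'
      obtain ⟨he, s₁, t₁, h₁, ht₁, hs₁⟩ := step (k - (j + 1)) (by omega) s' hf hs'
      have hf₁ : Frame (.loop e P) s s₁ :=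
        ⟨fun x hx => (h₁.frame.1 x hx).trans (hf.1 x hx),
          fun a ha => (h₁.frame.2 a ha).trans (hf.2 a ha)⟩
      obtain ⟨s₂, t₂, h₂, ht₂, hs₂⟩ := ih (by omega) s₁ hf₁
        (by rwa [show k - (j + 1) + 1 = k - j by omega] at hs₁)
      refine ⟨s₂, _, .loop_true he h₁ h₂, ?_, hs₂⟩
      rw [add_mul _ 1, one_mul]
      omega
  obtain ⟨s', t, h₁, h₂, h₃⟩ := key k le_rfl s ⟨fun _ _ => rfl, fun _ _ => rfl⟩ (by simpa using h₀)
  refine ⟨s', t, h₁, h₂.trans ?_, h₃⟩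
  simp only [Program.cost, Polynomial.eval_mul, Polynomial.eval_add, Polynomial.eval_X,
    Polynomial.eval_one, Polynomial.eval_natCast, Nat.cast_id]
  gcongr

end Runs

/-- `for x < reg y do P`, where register `b` holds `x * reg y`. -/
def forLoop (y x b : ℕ) (P : Program) : Program :=
  .seq (.assign x (.lit 0)) (.seq (.assign b (.lit 0)) (.loop (.lt (.reg x) (.reg y))
    (.seq P (.seq (.assign x (.add (.reg x) (.lit 1))) (.assign b (.add (.reg b) (.reg y)))))))

/-- Register `b` supplies row offsets without a multiplication instruction. Its final value, the
square of the bound, is kept because it serves to compute `n * n`. -/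
theorem Runs.forLoop {M : ℕ} {P : Program} {s : State} {y x b : ℕ}
    (hxy : x ≠ y) (hby : b ≠ y) (hbx : b ≠ x)
    (hP : P.writesReg y = false ∧ P.writesReg x = false ∧ P.writesReg b = false)
    (Inv : ℕ → State → Prop) (hM : s.reg y ≤ M)
    (h₀ : ∀ s', s'.arr = s.arr → (∀ z, z ≠ x → z ≠ b → s'.reg z = s.reg z) → Inv 0 s')
    (step : ∀ i < s.reg y, ∀ s', Frame (forLoop y x b P) s s' → s'.reg x = i →
      s'.reg b = i * s.reg y → Inv i s' →
      Runs M P s' fun s'' =>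
        Inv (i + 1) ((s''.setReg x (i + 1)).setReg b ((i + 1) * s.reg y))) :
    Runs M (forLoop y x b P) s fun s' => Inv (s.reg y) s' ∧ s'.reg b = s.reg y * s.reg y := by
  refine .seq (.assign (.seq (.assign (.mono (.loop hM
    (fun i s' => Inv i s' ∧ s'.reg x = i ∧ s'.reg b = i * s.reg y) ?_ ?_ ?_) ?_))))
  · refine ⟨h₀ _ rfl ?_, ?_, ?_⟩
    · intro z hz hz'
      simp [hz, hz']
    · simp [Expr.eval, hbx.symm]
    · simp [Expr.eval]
  · rintro i hi s' hf ⟨hI, hx, hb⟩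
    have hf' : Frame (RAM.forLoop y x b P) s s' := by
      refine ⟨fun z hz => ?_, fun a ha => ?_⟩
      · simp only [RAM.forLoop, Program.writesReg, Bool.or_eq_false_iff, beq_eq_false_iff_ne] at hz
        rw [hf.1 z (by simp [Program.writesReg, hz])]
        simp [hz]
      · simp only [RAM.forLoop, Program.writesArr, Bool.or_eq_false_iff] at ha
        rw [hf.2 a (by simp [Program.writesArr, ha])]
        simp
    have hy : s'.reg y = s.reg y :=
      hf'.1 y (by simp [RAM.forLoop, Program.writesReg, hP, hxy.symm, hby.symm])
    refine ⟨by simp [Expr.lt, Expr.eval, hx, hy]; omega, .seq (.mono (step i hi s' hf' hx hb hI) ?_)⟩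
    intro s'' hg hI'
    have e₁ := hg.1 x hP.2.1
    have e₂ := hg.1 b hP.2.2
    have e₃ := hg.1 y hP.1
    refine .seq (.assign (.assign ⟨?_, ?_, ?_⟩))
    · convert hI' using 2
      · simp [Expr.eval, e₁, hx]
      · simp [Expr.eval, hbx, hxy.symm, e₂, e₃, hb, hy]; ring
    · simp [Expr.eval, hbx.symm, e₁, hx]
    · simp [Expr.eval, hbx, hxy.symm, e₂, e₃, hb, hy]; ring
  · rintro s' hf ⟨hI, hx, hb⟩
    have hy : s'.reg y = s.reg y := by
      rw [hf.1 y (by simp [Program.writesReg, hP, hxy.symm, hby.symm])]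
      simp [hxy.symm, hby.symm]
    simp [Expr.eval, hx, hy]
  · rintro s' - ⟨hI, -, hb⟩
    exact ⟨hI, hb⟩

end RAM

/-! ### Ranks of edges and weights of nodes. -/

/-- A graph on `Fin n` with natural edge costs and degree bounds. -/
structure CostGraph (n : ℕ) where
  adj : Fin n → Fin n → Prop
  adj_symm : ∀ {u v}, adj u v → adj v u
  adj_irrefl : ∀ v, ¬ adj v v
  cost : Fin n → Fin n → ℕ
  cost_symm : ∀ u v, cost u v = cost v u
  req : Fin n → ℕ

namespace CostGraph

open Finset
open scoped Classical

variable {n : ℕ} (N : CostGraph n)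

/-- The number of neighbours `t` of `v` such that `vt` precedes `vu` in the order by cost, with ties
broken by the index. -/
noncomputable def rank (v u : Fin n) : ℕ :=
  #{t | N.adj v t ∧ (N.cost v t < N.cost v u ∨ N.cost v t ≤ N.cost v u ∧ t < u)}

/-- The cost of the edge at `v` that is the last one among the `req v` cheapest. -/
noncomputable def weight (v : Fin n) : ℕ :=
  ∑ u, if N.adj v u ∧ N.rank v u + 1 = N.req v then N.cost v u else 0

/-- The edge `vu` is not among the `req v - 1` cheapest edges at `v`. -/
def Outside (v u : Fin n) : Prop := N.req v ≤ N.rank v u + 1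

/-- `K` is the adjacency relation of a feasible solution. -/
structure Feasible (K : Fin n → Fin n → Prop) : Prop where
  symm : ∀ {u v}, K u v → K v u
  adj : ∀ {u v}, K u v → N.adj u v
  le_card : ∀ v, N.req v ≤ #{u | K v u}

variable {N}

theorem rank_lt_rank {v t u : Fin n} (ht : N.adj v t)
    (h : N.cost v t < N.cost v u ∨ N.cost v t ≤ N.cost v u ∧ t < u) :
    N.rank v t < N.rank v u := by
  refine card_lt_card ⟨fun x hx => ?_, fun hsub => ?_⟩
  · simp only [mem_filter, mem_univ, true_and] at hx ⊢
    refine ⟨hx.1, ?_⟩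
    have := hx.2
    omega
  · have := hsub (x := t) (by simpa using ⟨ht, h⟩)
    simp at this

theorem cost_le_of_rank_le {v u t : Fin n} (ht : N.adj v t) (h : N.rank v u ≤ N.rank v t) :
    N.cost v u ≤ N.cost v t := by
  by_contra hlt
  exact absurd (rank_lt_rank ht (.inl (not_le.1 hlt))) (not_lt.2 h)

theorem rank_inj {v u t : Fin n} (hu : N.adj v u) (ht : N.adj v t)
    (h : N.rank v u = N.rank v t) : u = t := by
  by_contra hne
  have h₁ := cost_le_of_rank_le ht h.le
  have h₂ := cost_le_of_rank_le hu h.ge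
  rcases lt_or_gt_of_ne hne with hlt | hlt
  · exact absurd (rank_lt_rank hu (.inr ⟨h₁, hlt⟩)) (by omega)
  · exact absurd (rank_lt_rank ht (.inr ⟨h₂, hlt⟩)) (by omega)

theorem card_rank_lt_le (v : Fin n) (m : ℕ) : #{u | N.adj v u ∧ N.rank v u < m} ≤ m := by
  have h := card_le_card_of_injOn (s := {u | N.adj v u ∧ N.rank v u < m}) (t := range m)
    (N.rank v) (fun u hu => by simpa using (mem_filter.1 hu).2.2)
    (fun u hu t ht h => by
      simp only [coe_filter, mem_univ, true_and, Set.mem_ofPred_eq] at hu ht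
      exact rank_inj hu.1 ht.1 h)
  simpa using h

theorem rank_lt_degree {v u : Fin n} (hu : N.adj v u) : N.rank v u < #{t | N.adj v t} := by
  refine card_lt_card ⟨fun x hx => ?_, fun hsub => ?_⟩
  · simp only [mem_filter, mem_univ, true_and] at hx ⊢
    exact hx.1
  · have := hsub (x := u) (by simpa using hu)
    simp at this

/-- Breaking ties by index makes the order at `v` strict, so ranks are distinct and below the
degree; by counting, they fill the whole range. -/
theorem image_rank (v : Fin n) :
    ({u | N.adj v u} : Finset (Fin n)).image (N.rank v) = range #{u | N.adj v u} := by
  refine eq_of_subset_of_card_le (fun m hm => ?_) ?_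
  · obtain ⟨u, hu, rfl⟩ := mem_image.1 hm
    simpa using rank_lt_degree (by simpa using hu)
  · rw [card_image_of_injOn, card_range]
    intro u hu t ht h
    simp only [coe_filter, mem_univ, true_and, Set.mem_ofPred_eq] at hu ht
    exact rank_inj hu ht h

theorem exists_rank_eq {v : Fin n} {m : ℕ} (hm : m < #{u | N.adj v u}) :
    ∃ u, N.adj v u ∧ N.rank v u = m := by
  have : m ∈ ({u | N.adj v u} : Finset (Fin n)).image (N.rank v) := by
    rw [image_rank]; simpa using hm
  simpa using this

theorem le_card_rank_lt {v : Fin n} {m : ℕ} (hm : m ≤ #{u | N.adj v u}) :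
    m ≤ #{u | N.adj v u ∧ N.rank v u < m} := by
  have h : range m ⊆ ({u | N.adj v u ∧ N.rank v u < m} : Finset (Fin n)).image (N.rank v) := by
    intro i hi
    obtain ⟨u, hu, rfl⟩ := exists_rank_eq ((mem_range.1 hi).trans_le hm)
    exact mem_image_of_mem _ (by simpa using ⟨hu, mem_range.1 hi⟩)
  simpa using (card_le_card h).trans card_image_le

theorem weight_eq {v u : Fin n} (hu : N.adj v u) (h : N.rank v u + 1 = N.req v) :
    N.weight v = N.cost v u := by
  rw [weight, sum_eq_single u, if_pos ⟨hu, h⟩]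
  · intro t _ hne
    refine if_neg fun ht => hne (rank_inj ht.1 hu (by omega))
  · simp

theorem weight_eq_zero {v : Fin n} (h : N.req v = 0) : N.weight v = 0 := by
  simp [weight, h]

/-! ### Lower bounds from a feasible solution, and its decomposition into stars. -/

namespace Feasible

variable {K : Fin n → Fin n → Prop} (hK : N.Feasible K)
include hK

theorem req_le_degree (v : Fin n) : N.req v ≤ #{u | N.adj v u} :=
  (hK.le_card v).trans (card_le_card fun u hu => by
    simp only [mem_filter, mem_univ, true_and] at hu ⊢
    exact hK.adj hu)

/-- Feasibility is needed only to make the degree at least `req v`, so that an edge of rank `req v -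
1` exists and `weight` is not the default value 0. -/
theorem cost_le_weight {v u : Fin n} (h : N.rank v u < N.req v) :
    N.cost v u ≤ N.weight v := by
  obtain ⟨t, ht, hr⟩ := exists_rank_eq (N := N) (v := v) (m := N.req v - 1)
    (by have := hK.req_le_degree v; omega)
  rw [weight_eq ht (by omega)]
  exact cost_le_of_rank_le ht (by omega)

theorem weight_le_cost {v u : Fin n} (hu : N.adj v u) (h : N.Outside v u) :
    N.weight v ≤ N.cost v u := by
  rcases Nat.eq_zero_or_pos (N.req v) with h₀ | h₀
  · simp [weight_eq_zero h₀]
  obtain ⟨t, ht, hr⟩ := exists_rank_eq (N := N) (v := v) (m := N.req v - 1)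
    (by have := hK.req_le_degree v; omega)
  rw [weight_eq ht (by omega)]
  refine cost_le_of_rank_le hu ?_
  unfold Outside at h
  omega

/-- At most `req v - 1` neighbours have rank below `req v - 1`, too few for all the edges of `K` at
`v`. -/
theorem exists_outside {v : Fin n} (h : 0 < N.req v) : ∃ u, K v u ∧ N.Outside v u := by
  by_contra! hcon
  have h₁ : #{u | K v u} ≤ #{u | N.adj v u ∧ N.rank v u < N.req v - 1} := by
    refine card_le_card fun u hu => ?_
    simp only [mem_filter, mem_univ, true_and] at hu ⊢
    have := hcon u hu
    unfold Outside at this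
    exact ⟨hK.adj hu, by omega⟩
  have h₂ := card_rank_lt_le (N := N) v (N.req v - 1)
  have h₃ := hK.le_card v
  omega

theorem weight_le {P : Fin n → ℕ} (hP : ∀ v u, K v u → N.cost v u ≤ P v) (v : Fin n) :
    N.weight v ≤ P v := by
  rcases Nat.eq_zero_or_pos (N.req v) with h₀ | h₀
  · simp [weight_eq_zero h₀]
  obtain ⟨u, hu, ho⟩ := hK.exists_outside h₀
  exact (hK.weight_le_cost (hK.adj hu) ho).trans (hP v u hu)

/-- A minimal subgraph of a feasible solution that contains, for every node `v` of `R`, an edge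
outside of the `req v - 1` cheapest ones decomposes into stars, given by the relation from leaves to
centers. -/
theorem exists_stars {R : Fin n → Prop} (hR : ∀ v, R v → 0 < N.req v) :
    ∃ L : Fin n → Fin n → Prop,
      (∀ v s, L v s → R v ∧ K v s ∧ N.Outside v s) ∧
      (∀ v s s', L v s → L v s' → s = s') ∧
      (∀ v s u, L v s → L u v → ¬ N.Outside v u) ∧
      (∀ v, R v → (∃ s, L v s) ∨ ∃ u, L u v ∧ N.Outside v u) := by
  let good : Finset (Sym2 (Fin n)) → Prop := fun I =>
    (∀ v u, s(v, u) ∈ I → K v u) ∧ ∀ v, R v → ∃ u, s(v, u) ∈ I ∧ N.Outside v u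
  have hgood : good {e | ∃ v u, e = s(v, u) ∧ K v u} := by
    refine ⟨fun v u h => ?_, fun v hv => ?_⟩
    · simp only [mem_filter, mem_univ, true_and, Sym2.eq_iff] at h
      obtain ⟨a, b, ⟨rfl, rfl⟩ | ⟨rfl, rfl⟩, hab⟩ := h
      · exact hab
      · exact hK.symm hab
    · obtain ⟨u, hu, ho⟩ := hK.exists_outside (hR v hv)
      exact ⟨u, by simpa using ⟨v, u, .inl ⟨rfl, rfl⟩, hu⟩, ho⟩
  obtain ⟨I, hI⟩ := exists_minimal_of_wellFoundedLT good ⟨_, hgood⟩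
  -- By minimality, removing an edge leaves some node of `R` without an outside edge. That node,
  -- `p.1`, is made the leaf and `p.2` the center; the edge is the only outside edge of `I` at the
  -- leaf.
  have crit : ∀ e : I, ∃ p : Fin n × Fin n, e.1 = s(p.1, p.2) ∧ R p.1 ∧ N.Outside p.1 p.2 ∧
      ∀ u, s(p.1, u) ∈ I → N.Outside p.1 u → u = p.2 := by
    rintro ⟨e, he⟩
    have hng : ¬ good (I.erase e) := fun h =>
      notMem_erase e I (hI.2 h (erase_subset e I) he)
    have : ∃ v, R v ∧ ∀ u, s(v, u) ∈ I.erase e → ¬ N.Outside v u := by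
      by_contra! hcon
      exact hng ⟨fun v u h => hI.1.1 v u (mem_of_mem_erase h), hcon⟩
    obtain ⟨v, hv, hvu⟩ := this
    obtain ⟨s, hs, ho⟩ := hI.1.2 v hv
    have heq : ∀ u, s(v, u) ∈ I → N.Outside v u → s(v, u) = e := fun u h₁ h₂ => by
      by_contra hne
      exact hvu u (mem_erase.2 ⟨hne, h₁⟩) h₂
    refine ⟨(v, s), (heq s hs ho).symm, hv, ho, fun u h₁ h₂ => ?_⟩
    have := (heq u h₁ h₂).trans (heq s hs ho).symm
    exact Sym2.congr_right.1 this
  choose p hp hpR hpo hpu using crit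
  refine ⟨fun v s => ∃ e, p e = (v, s), ?_, ?_, ?_, ?_⟩
  · rintro v s ⟨e, he⟩
    have h₁ := hp e
    have h₂ := hpR e
    have h₃ := hpo e
    rw [he] at h₁ h₂ h₃
    exact ⟨h₂, hI.1.1 v s (h₁ ▸ e.2), h₃⟩
  · rintro v s s' ⟨e, he⟩ ⟨e', he'⟩
    have h₁ := hpu e s'
    have h₂ := hp e'
    have h₃ := hpo e'
    rw [he] at h₁
    rw [he'] at h₂ h₃
    exact (h₁ (h₂ ▸ e'.2) h₃).symm
  -- If `uv` were outside at the leaf `v`, it would be the critical edge of `v`. One edge would then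
  -- have both `u` and `v` as its leaf, which forces a loop.
  · rintro v s u ⟨e, he⟩ ⟨e', he'⟩ ho
    have h₁ := hpu e u
    have h₂ := hp e'
    have h₃ := hp e
    rw [he] at h₁ h₃
    rw [he'] at h₂
    simp only [Sym2.eq_swap (a := u)] at h₂
    have hus : u = s := h₁ (h₂ ▸ e'.2) ho
    subst hus
    have : e = e' := Subtype.ext (h₃.trans h₂.symm)
    subst this
    rw [he] at he'
    simp only [Prod.mk.injEq] at he'
    have hadj : N.adj v u := hK.adj (hI.1.1 v u (h₃ ▸ e.2))
    rw [he'.2] at hadj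
    exact N.adj_irrefl v hadj
  · intro v hv
    obtain ⟨u, hu, ho⟩ := hI.1.2 v hv
    have h := hp ⟨s(v, u), hu⟩
    simp only [Sym2.eq_iff] at h
    rcases h with ⟨h₁, h₂⟩ | ⟨h₁, h₂⟩
    · exact .inl ⟨u, ⟨s(v, u), hu⟩, Prod.ext h₁.symm h₂.symm⟩
    · exact .inr ⟨u, ⟨⟨s(v, u), hu⟩, Prod.ext h₂.symm h₁.symm⟩, ho⟩

end Feasible

/-! ### The uncovered weight when no profitable star is left. -/

variable (N) in
/-- No set of uncovered leaves at the center `s`, among them `y`, pays for half of the increase of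
power when `s` gets the power that the edge `sy` needs. -/
def NoStar (covered : Fin n → Prop) (s y : Fin n) : Prop :=
  N.adj s y → ¬ covered y → N.Outside y s → ∀ A : Finset (Fin n), y ∈ A →
    (∀ u ∈ A, N.adj s u ∧ ¬ covered u ∧ N.Outside u s ∧
      N.cost s u ≤ max (N.cost s y) (N.weight s)) →
    (∑ u ∈ A, N.weight u) + (if ¬ covered s ∧ N.Outside s y then N.weight s else 0) ≤
      2 * (∑ u ∈ A, (N.cost s u - N.weight u)) +
        2 * (max (N.cost s y) (N.weight s) - N.weight s)

/-- Covering more nodes leaves fewer admissible leaf sets and can only lose the center's term. Hence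
a star once rejected never becomes profitable, and one pass is enough. -/
theorem NoStar.mono {c c' : Fin n → Prop} {s y : Fin n} (h : N.NoStar c s y)
    (hc : ∀ v, c v → c' v) : N.NoStar c' s y := by
  intro h₁ h₂ h₃ A hy hA
  refine le_trans ?_ (h h₁ (mt (hc y) h₂) h₃ A hy fun u hu =>
    ⟨(hA u hu).1, mt (hc u) (hA u hu).2.1, (hA u hu).2.2⟩)
  gcongr
  split_ifs with h₄ h₅
  · exact le_rfl
  · exact absurd ⟨mt (hc s) h₄.1, h₄.2⟩ h₅
  · exact Nat.zero_le _
  · exact le_rfl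

/-- `NoStar` is applied to each star of the decomposition of `K`, and the increases are charged to
nodes so that `v` pays at most `P v - weight v` in total. -/
theorem Feasible.sum_uncovered_le {K : Fin n → Fin n → Prop} (hK : N.Feasible K) {P : Fin n → ℕ}
    (hP : ∀ v u, K v u → N.cost v u ≤ P v) {c : Fin n → Prop} (hc : ∀ s y, N.NoStar c s y) :
    (∑ v, if c v then 0 else N.weight v) ≤ 2 * ∑ v, (P v - N.weight v) := by
  obtain ⟨L, hL, hLu, hLc, hLR⟩ := hK.exists_stars (R := fun v => ¬ c v ∧ 0 < N.req v)
    fun v hv => hv.2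
  -- `cw s` is the weight of a center that is served by one of its own leaves; `z s` is what `s` may
  -- pay as a center, nothing if it already pays as a leaf.
  let cw : Fin n → ℕ := fun s => if ¬ c s ∧ ∃ u, L u s ∧ N.Outside s u then N.weight s else 0
  let z : Fin n → ℕ := fun s => if ∃ t, L s t then 0 else P s - N.weight s
  have star : ∀ s, (∑ v, if L v s then N.weight v else 0) + cw s ≤
      2 * (∑ v, if L v s then N.cost s v - N.weight v else 0) + 2 * z s := by
    intro s
    by_cases hne : ∃ u, L u s
    swap
    · have : ∀ v, ¬ L v s := not_exists.1 hne
      simp [cw, this]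
    -- The level of the star is its most expensive edge outside at `s`. All other edges to leaves
    -- cost at most `weight s`, so any leaf will do if none is outside.
    have hy : ∃ y, L y s ∧ ((∃ u, L u s ∧ N.Outside s u) → N.Outside s y) ∧
        ∀ u, L u s → N.cost s u ≤ max (N.cost s y) (N.weight s) := by
      by_cases ho : ∃ u, L u s ∧ N.Outside s u
      · obtain ⟨u₀, hu₀⟩ := ho
        obtain ⟨y, hy, hmax⟩ := exists_max_image {u | L u s ∧ N.Outside s u} (N.cost s)
          ⟨u₀, by simpa using hu₀⟩
        simp only [mem_filter, mem_univ, true_and] at hy hmax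
        refine ⟨y, hy.1, fun _ => hy.2, fun u hu => ?_⟩
        by_cases hou : N.Outside s u
        · exact le_max_of_le_left (hmax u ⟨hu, hou⟩)
        · unfold Outside at hou
          exact le_max_of_le_right (hK.cost_le_weight (by omega))
      · obtain ⟨y, hy⟩ := hne
        refine ⟨y, hy, fun h => absurd h ho, fun u hu => ?_⟩
        have hou : ¬ N.Outside s u := fun h => ho ⟨u, hu, h⟩
        unfold Outside at hou
        exact le_max_of_le_right (hK.cost_le_weight (by omega))
    obtain ⟨y, hy, hyo, hmax⟩ := hy
    have hadj : ∀ u, L u s → N.adj s u := fun u hu => N.adj_symm (hK.adj (hL u s hu).2.1)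
    have key := hc s y (hadj y hy) (hL y s hy).1.1 (hL y s hy).2.2 {v | L v s} (by simpa using hy)
      (fun u hu => by
        have hu : L u s := by simpa using hu
        exact ⟨hadj u hu, (hL u s hu).1.1, (hL u s hu).2.2, hmax u hu⟩)
    rw [sum_filter, sum_filter] at key
    have h₁ : cw s ≤ if ¬ c s ∧ N.Outside s y then N.weight s else 0 := by
      simp only [cw]
      split_ifs with h₄ h₅
      · exact le_rfl
      · exact absurd ⟨h₄.1, hyo h₄.2⟩ h₅
      · exact Nat.zero_le _
      · exact le_rfl
    have h₂ : max (N.cost s y) (N.weight s) - N.weight s ≤ z s := by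
      simp only [z]
      split_ifs with h
      -- A center that is also a leaf has no outside edge to its own leaves, so its power need not
      -- grow.
      · obtain ⟨t, ht⟩ := h
        have hou := hLc s t y ht hy
        unfold Outside at hou
        have := hK.cost_le_weight (N := N) (v := s) (u := y) (by omega)
        omega
      · have := hP s y (hK.symm (hL y s hy).2.1)
        have := hK.weight_le hP s
        omega
    omega
  have hsum := sum_le_sum fun s (_ : s ∈ univ) => star s
  simp only [sum_add_distrib, ← mul_sum] at hsum
  rw [sum_comm, sum_comm (f := fun s v => if L v s then N.cost s v - N.weight v else 0)] at hsum
  have left : ∀ v, (if c v then 0 else N.weight v) ≤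
      (∑ s, if L v s then N.weight v else 0) + cw v := by
    intro v
    split_ifs with hv
    · exact Nat.zero_le _
    rcases Nat.eq_zero_or_pos (N.req v) with h₀ | h₀
    · simp [weight_eq_zero h₀]
    rcases hLR v ⟨hv, h₀⟩ with ⟨s, hs⟩ | h
    · refine le_add_right (le_trans ?_ (single_le_sum (fun _ _ => Nat.zero_le _) (mem_univ s)))
      rw [if_pos hs]
    · refine le_add_left ?_
      simp only [cw]
      rw [if_pos ⟨hv, h⟩]
  have right : ∀ v, (∑ s, if L v s then N.cost s v - N.weight v else 0) + z v ≤
      P v - N.weight v := by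
    intro v
    by_cases h : ∃ t, L v t
    · obtain ⟨t, ht⟩ := h
      rw [sum_eq_single t]
      · have := hP v t (hL v t ht).2.1
        rw [N.cost_symm] at this
        simp only [z, if_pos ht, if_pos (⟨t, ht⟩ : ∃ t, L v t)]
        omega
      · exact fun s _ hs => if_neg fun h => hs (hLu v s t h ht)
      · simp
    · have h' : ∀ t, ¬ L v t := not_exists.1 h
      simp [z, h']
  have h₁ := sum_le_sum fun v (_ : v ∈ univ) => left v
  have h₂ := sum_le_sum fun v (_ : v ∈ univ) => right v
  simp only [sum_add_distrib] at h₁ h₂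
  omega

end CostGraph

/-! ### The greedy pass over the stars. -/

namespace CostGraph

open Finset
open scoped Classical

variable {n : ℕ} {N : CostGraph n}

variable (N) in
/-- The leaves that are selected for the center `s` at the level of the edge `sy`. -/
noncomputable def starSet (c : Fin n → Prop) (s y : Fin n) : Finset (Fin n) :=
  {u | N.adj s u ∧ ¬ c u ∧ N.Outside u s ∧
    (u = y ∨ N.cost s u ≤ max (N.cost s y) (N.weight s) ∧ 2 * N.cost s u < 3 * N.weight u)}

variable (N) in
/-- The total weight of the nodes that the star covers. -/
noncomputable def gain (c : Fin n → Prop) (s y : Fin n) : ℕ :=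
  (∑ u ∈ N.starSet c s y, N.weight u) + if ¬ c s ∧ N.Outside s y then N.weight s else 0

variable (N) in
/-- Twice the increase of power that the star needs. -/
noncomputable def price (c : Fin n → Prop) (s y : Fin n) : ℕ :=
  2 * (max (N.cost s y) (N.weight s) - N.weight s) +
    ∑ u ∈ N.starSet c s y, 2 * (N.cost s u - N.weight u)

theorem mem_starSet {c : Fin n → Prop} {s y u : Fin n} : u ∈ N.starSet c s y ↔
    N.adj s u ∧ ¬ c u ∧ N.Outside u s ∧ (u = y ∨
      N.cost s u ≤ max (N.cost s y) (N.weight s) ∧ 2 * N.cost s u < 3 * N.weight u) := by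
  simp [starSet]

/-- A leaf `u` adds w(u) - 2(c(su) - w(u)) = 3w(u) - 2c(su) to gain minus price when c(su) ≥ w(u).
Keeping `y` and exactly the leaves with `2c < 3w` is thus best among all admissible sets at this
level. Truncation does no harm: a rejected leaf has c ≥ w, and an accepted one contributes
nonnegatively. -/
theorem noStar_of_gain_le {c : Fin n → Prop} {s y : Fin n} (h : N.gain c s y ≤ N.price c s y) :
    N.NoStar c s y := by
  intro h₁ h₂ h₃ A hy hA
  have key : (∑ u ∈ A, N.weight u) + ∑ u ∈ N.starSet c s y, 2 * (N.cost s u - N.weight u) ≤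
      (∑ u ∈ A, 2 * (N.cost s u - N.weight u)) + ∑ u ∈ N.starSet c s y, N.weight u := by
    rw [← sum_ite_mem_eq A, ← sum_ite_mem_eq (N.starSet c s y), ← sum_ite_mem_eq A,
      ← sum_ite_mem_eq (N.starSet c s y), ← sum_add_distrib, ← sum_add_distrib]
    refine sum_le_sum fun u _ => ?_
    by_cases hu : u ∈ A <;> by_cases hu' : u ∈ N.starSet c s y <;> simp only [hu, hu', if_true,
      if_false]
    · omega
    · have := hA u hu
      have : ¬ 2 * N.cost s u < 3 * N.weight u := fun h =>
        hu' (mem_starSet.2 ⟨this.1, this.2.1, this.2.2.1, .inr ⟨this.2.2.2, h⟩⟩)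
      omega
    · have := (mem_starSet.1 hu').2.2.2
      rcases this with rfl | h
      · exact absurd hy hu
      · omega
    · exact le_rfl
  unfold gain price at h
  rw [mul_sum]
  omega

variable (N) in
/-- The state of the pass over the stars: `J` are the selected edges, `c` the nodes that have been
covered, `seen` the stars that have been tried. -/
structure Progress (J : Fin n → Fin n → Prop) (c : Fin n → Prop) (seen : Fin n → Fin n → Prop) :
    Prop where
  adj : ∀ u v, J u v → N.adj u v
  budget : ∃ b : Fin n → ℕ, (∀ v, N.weight v ≤ b v) ∧
    (∀ u v, J u v → N.cost u v ≤ b u ∧ N.cost u v ≤ b v) ∧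
    2 * ∑ v, b v ≤ 2 * ∑ v, N.weight v + ∑ v, if c v then N.weight v else 0
  covered : ∀ v, c v → ∃ u, (J v u ∨ J u v) ∧ N.Outside v u
  noStar : ∀ s y, seen s y → N.NoStar c s y

theorem Progress.init : N.Progress (fun _ _ => False) (fun _ => False) (fun _ _ => False) where
  adj _ _ h := h.elim
  budget := ⟨N.weight, fun _ => le_rfl, fun _ _ h => h.elim, by simp⟩
  covered _ h := h.elim
  noStar _ _ h := h.elim

namespace Progress

variable {J : Fin n → Fin n → Prop} {c : Fin n → Prop} {seen seen' : Fin n → Fin n → Prop}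

theorem skip (h : N.Progress J c seen)
    (hs : ∀ s y, seen' s y → seen s y ∨ N.NoStar c s y) : N.Progress J c seen' where
  adj := h.adj
  budget := h.budget
  covered := h.covered
  noStar s y hsy := (hs s y hsy).elim (h.noStar s y) id

/-- The newly covered weight exceeds twice the increase of the budget, which preserves the budget
inequality. The pair `(s, y)` needs no further attention because `y` is now covered. -/
theorem select (h : N.Progress J c seen) {s y : Fin n} (hadj : N.adj s y) (hy : ¬ c y)
    (ho : N.Outside y s) (hlt : N.price c s y < N.gain c s y)
    (hs : ∀ a b, seen' a b → seen a b ∨ a = s ∧ b = y) :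
    N.Progress (fun a b => J a b ∨ a = s ∧ b ∈ N.starSet c s y)
      (fun v => c v ∨ v ∈ N.starSet c s y ∨ v = s ∧ N.Outside s y) seen' where
  adj u v := by
    rintro (h' | ⟨rfl, hv⟩)
    · exact h.adj u v h'
    · exact (mem_starSet.1 hv).1
  budget := by
    obtain ⟨b, hb, hJ, hsum⟩ := h.budget
    refine ⟨fun v => b v + ((if v ∈ N.starSet c s y then N.cost s v - N.weight v else 0) +
      if v = s then max (N.cost s y) (N.weight s) - N.weight s else 0),
      fun v => (hb v).trans (Nat.le_add_right _ _), ?_, ?_⟩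
    · rintro u v (h' | ⟨rfl, hv⟩)
      · have := hJ u v h'
        exact ⟨this.1.trans (Nat.le_add_right _ _), this.2.trans (Nat.le_add_right _ _)⟩
      · have h₁ := hb u
        have h₂ := hb v
        have h₃ : N.cost u v ≤ max (N.cost u y) (N.weight u) := by
          rcases (mem_starSet.1 hv).2.2.2 with rfl | h
          · exact le_max_left _ _
          · exact h.1
        simp only [hv, if_true]
        constructor <;> omega
    -- The center is not its own leaf, so its weight is not counted twice in the gain.
    · have hsS : s ∉ N.starSet c s y := fun h' => N.adj_irrefl s (mem_starSet.1 h').1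
      have hg : ∀ c' : Fin n → Prop,
          (∀ v, c' v ↔ c v ∨ v ∈ N.starSet c s y ∨ v = s ∧ N.Outside s y) →
          N.gain c s y + (∑ v, if c v then N.weight v else 0) ≤
            ∑ v, if c' v then N.weight v else 0 := by
        intro c' hc'
        have : (if ¬ c s ∧ N.Outside s y then N.weight s else 0) =
            ∑ v, if v = s then (if ¬ c s ∧ N.Outside s y then N.weight s else 0) else 0 := by simp
        rw [gain, this, ← sum_ite_mem_eq (N.starSet c s y), ← sum_add_distrib, ← sum_add_distrib]
        refine sum_le_sum fun v _ => ?_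
        by_cases hv : v ∈ N.starSet c s y
        · have h₁ : v ≠ s := fun h => hsS (h ▸ hv)
          simp [hc', hv, h₁, (mem_starSet.1 hv).2.1]
        · by_cases hvs : v = s
          · subst hvs
            by_cases hc : c v <;> simp [hc', hv, hc]
          · simp [hc', hv, hvs]
      have hp : 2 * (∑ v, ((if v ∈ N.starSet c s y then N.cost s v - N.weight v else 0) +
          if v = s then max (N.cost s y) (N.weight s) - N.weight s else 0)) = N.price c s y := by
        rw [price, sum_add_distrib, sum_ite_mem_eq, ← mul_sum]
        simp
        ring
      rw [sum_add_distrib, mul_add, hp]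
      have := hg _ fun v => Iff.rfl
      omega
  covered := by
    rintro v (hv | hv | ⟨rfl, hv⟩)
    · obtain ⟨u, hu, hvu⟩ := h.covered v hv
      exact ⟨u, hu.imp .inl .inl, hvu⟩
    · exact ⟨s, .inr (.inr ⟨rfl, hv⟩), (mem_starSet.1 hv).2.2.1⟩
    · exact ⟨y, .inl (.inr ⟨rfl, mem_starSet.2 ⟨hadj, hy, ho, .inl rfl⟩⟩), hv⟩
  noStar a b hab := by
    rcases hs a b hab with h' | ⟨rfl, rfl⟩
    · exact (h.noStar a b h').mono fun v => .inl
    · exact fun h₁ h₂ h₃ => absurd (.inr (.inl (mem_starSet.2 ⟨hadj, hy, ho, .inl rfl⟩))) h₂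

end Progress

/-! ### The final choice of edges and the approximation ratio. -/

variable (N) in
/-- The edges `vu` that are chosen by the node `v` in the end. -/
def Chosen (c : Fin n → Prop) (v u : Fin n) : Prop :=
  N.adj v u ∧ (N.rank v u + 1 < N.req v ∨ ¬ c v ∧ N.rank v u < N.req v)

variable {J : Fin n → Fin n → Prop} {c : Fin n → Prop} {seen : Fin n → Fin n → Prop}
  {K : Fin n → Fin n → Prop}

/-- A covered node has its `req v - 1` cheapest edges and a selected edge whose rank is too large to
be one of them. -/
theorem Progress.isCover (h : N.Progress J c seen) (hK : N.Feasible K) (v : Fin n) :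
    N.req v ≤ #{u | (J v u ∨ N.Chosen c v u) ∨ (J u v ∨ N.Chosen c u v)} := by
  have hdeg := hK.req_le_degree v
  by_cases hv : c v
  · obtain ⟨u, hu, ho⟩ := h.covered v hv
    have h₁ : insert u ({u | N.adj v u ∧ N.rank v u < N.req v - 1} : Finset (Fin n)) ⊆
        ({u | (J v u ∨ N.Chosen c v u) ∨ (J u v ∨ N.Chosen c u v)} : Finset (Fin n)) := by
      intro t ht
      simp only [mem_insert, mem_filter, mem_univ, true_and] at ht ⊢
      rcases ht with rfl | ht
      · exact hu.imp .inl .inl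
      · exact .inl (.inr ⟨ht.1, .inl (by omega)⟩)
    refine le_trans ?_ (card_le_card h₁)
    have h₂ := le_card_rank_lt (N := N) (v := v) (m := N.req v - 1) (by omega)
    unfold Outside at ho
    rw [card_insert_of_notMem (by simp only [mem_filter]; omega)]
    omega
  · refine (le_card_rank_lt hdeg).trans (card_le_card fun u hu => ?_)
    simp only [mem_filter, mem_univ, true_and] at hu ⊢
    exact .inl (.inr ⟨hu.1, .inr ⟨hv, hu.2⟩⟩)

theorem Progress.exists_budget (h : N.Progress J c fun _ _ => True) (hK : N.Feasible K)
    {P : Fin n → ℕ} (hP : ∀ v u, K v u → N.cost v u ≤ P v) {k : ℕ} (hk : ∀ v, N.req v ≤ k) :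
    ∃ b : Fin n → ℕ, (∀ u v, J u v ∨ N.Chosen c u v → N.cost u v ≤ b u ∧ N.cost u v ≤ b v) ∧
      2 * ∑ v, b v ≤ (2 * k + 1) * ∑ v, P v := by
  obtain ⟨b, hb, hJ, hsum⟩ := h.budget
  have hCw : ∀ v u, N.Chosen c v u → N.cost v u ≤ N.weight v := fun v u hvu =>
    hK.cost_le_weight (by have := hvu.2; omega)
  -- The chooser `u` pays nothing extra, since the cost is at most `weight u ≤ b u`; the other
  -- endpoint pays the full cost of each edge it receives.
  refine ⟨fun v => b v + ∑ u, if N.Chosen c u v then N.cost u v else 0, ?_, ?_⟩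
  · rintro u v (h' | h')
    · have := hJ u v h'
      exact ⟨this.1.trans (Nat.le_add_right _ _), this.2.trans (Nat.le_add_right _ _)⟩
    · refine ⟨((hCw u v h').trans (hb u)).trans (Nat.le_add_right _ _), le_add_left ?_⟩
      refine le_trans ?_ (single_le_sum (fun _ _ => Nat.zero_le _) (mem_univ u))
      rw [if_pos h']
  · have hnode : ∀ v, (∑ u, if N.Chosen c v u then N.cost v u else 0) + N.weight v ≤
        k * N.weight v + if c v then 0 else N.weight v := by
      intro v
      rcases Nat.eq_zero_or_pos (N.req v) with h₀ | h₀
      · simp [Chosen, h₀, weight_eq_zero h₀]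
      have h₁ : ∀ m, (∀ u, N.Chosen c v u → N.rank v u < m) →
          (∑ u, if N.Chosen c v u then N.cost v u else 0) ≤ m * N.weight v := by
        intro m hm
        rw [← sum_filter]
        refine (sum_le_card_nsmul _ _ (N.weight v) fun u hu => hCw v u (mem_filter.1 hu).2).trans ?_
        rw [smul_eq_mul]
        gcongr
        refine le_trans (card_le_card fun u hu => ?_) (card_rank_lt_le (N := N) v m)
        simp only [mem_filter, mem_univ, true_and] at hu ⊢
        exact ⟨hu.1, hm u hu⟩
      by_cases hv : c v
      · have h₂ := h₁ (N.req v - 1) fun u hu => by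
          rcases hu.2 with h | h
          · omega
          · exact absurd hv h.1
        rw [if_pos hv, add_zero]
        calc _ ≤ (N.req v - 1) * N.weight v + N.weight v := by omega
          _ = (N.req v - 1 + 1) * N.weight v := by ring
          _ ≤ k * N.weight v := Nat.mul_le_mul_right _ (by have := hk v; omega)
      · have h₂ := h₁ (N.req v) fun u hu => by have := hu.2; omega
        have h₃ := Nat.mul_le_mul_right (N.weight v) (hk v)
        rw [if_neg hv]
        omega
    have hnodes := sum_le_sum fun v (_ : v ∈ univ) => hnode v
    simp only [sum_add_distrib, ← mul_sum] at hnodes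
    have hunc := hK.sum_uncovered_le hP fun s y => h.noStar s y trivial
    have hsplit : (∑ v, if c v then N.weight v else 0) + (∑ v, if c v then 0 else N.weight v) =
        ∑ v, N.weight v := by
      rw [← sum_add_distrib]
      exact sum_congr rfl fun v _ => by split_ifs <;> simp
    have hdiff : (∑ v, N.weight v) + ∑ v, (P v - N.weight v) = ∑ v, P v := by
      rw [← sum_add_distrib]
      exact sum_congr rfl fun v _ => Nat.add_sub_cancel' (hK.weight_le hP v)
    rw [sum_add_distrib, sum_comm]
    -- Absorbing 2 Σ(P-w) into (2k+1) Σ(P-w) needs k ≥ 1. For k = 0 all weights vanish.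
    rcases Nat.eq_zero_or_pos k with rfl | hk₀
    · have : ∑ v, N.weight v = 0 :=
        sum_eq_zero fun v _ => weight_eq_zero (Nat.le_zero.1 (hk v))
      omega
    · have h₁ : ∑ v, (P v - N.weight v) ≤ k * ∑ v, (P v - N.weight v) :=
        Nat.le_mul_of_pos_left _ hk₀
      have h₂ : (2 * k + 1) * ((∑ v, N.weight v) + ∑ v, (P v - N.weight v)) =
          2 * (k * ∑ v, N.weight v) + (∑ v, N.weight v) +
            2 * (k * ∑ v, (P v - N.weight v)) + ∑ v, (P v - N.weight v) := by ring
      rw [← hdiff, h₂, mul_add]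
      omega

end CostGraph

/-! ### Multiplication and scaling on the machine. -/

namespace RAM

/-- Binary multiplication of registers `6` and `7` into register `8`. -/
def mulProg : Program :=
  .seq (.assign 8 (.lit 0)) (.loop (.reg 7)
    (.seq (.ite (.sub (.reg 7) (.add (.half (.reg 7)) (.half (.reg 7))))
      (.assign 8 (.add (.reg 8) (.reg 6))) .noop)
      (.seq (.assign 6 (.add (.reg 6) (.reg 6))) (.assign 7 (.half (.reg 7))))))

/-- Each round moves the lowest bit of register `7` into the accumulator, preserving `reg 8 + reg 6
* reg 7`. The number of rounds is the bit length of register `7` alone. -/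
theorem runs_mulProg {M : ℕ} {s : State} (hM : (s.reg 7).size ≤ M) :
    Runs M mulProg s fun s' => s'.reg 8 = s.reg 6 * s.reg 7 := by
  refine .seq (.assign (.mono (.loop hM (fun i s' =>
    s'.reg 8 + s'.reg 6 * s'.reg 7 = s.reg 6 * s.reg 7 ∧ s'.reg 7 = s.reg 7 / 2 ^ i) ?_ ?_ ?_) ?_))
  · simp [Expr.eval]
  · rintro i hi s' - ⟨h₁, h₂⟩
    have hne : s'.reg 7 ≠ 0 := by
      rw [h₂]
      exact (Nat.div_pos (Nat.lt_size.1 hi) (by positivity)).ne'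
    have hdiv : s'.reg 7 / 2 = s.reg 7 / 2 ^ (i + 1) := by
      rw [h₂, Nat.div_div_eq_div_mul, pow_succ]
    refine ⟨hne, .seq (.ite (fun he => ?_) fun he => ?_)⟩
    · refine .assign (.seq (.assign (.assign ⟨?_, by simpa [Expr.eval] using hdiv⟩)))
      simp only [Expr.eval] at he
      simp only [Expr.eval, State.setReg_reg]
      norm_num
      rw [← h₁]
      obtain ⟨h, hh⟩ : ∃ h, s'.reg 7 = 2 * h + 1 := ⟨s'.reg 7 / 2, by omega⟩
      rw [hh, show (2 * h + 1) / 2 = h by omega]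
      ring
    · refine .noop (.seq (.assign (.assign ⟨?_, by simpa [Expr.eval] using hdiv⟩)))
      simp only [Expr.eval] at he
      simp only [Expr.eval, State.setReg_reg]
      norm_num
      rw [← h₁]
      obtain ⟨h, hh⟩ : ∃ h, s'.reg 7 = 2 * h := ⟨s'.reg 7 / 2, by omega⟩
      rw [hh, show (2 * h) / 2 = h by omega]
      ring
  · rintro s' - ⟨-, h₂⟩
    simpa [Expr.eval, h₂] using Nat.lt_size_self _
  · rintro s' - ⟨h₁, h₂⟩
    rw [Nat.div_eq_of_lt (Nat.lt_size_self _)] at h₂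
    simpa [h₂] using h₁

/-- Multiplication of every entry of array `1` by all nonzero entries of array `2` in other
positions; register `1` holds the length of the arrays. -/
def scaleProg : Program :=
  forLoop 1 2 3 (forLoop 1 4 5 (.ite (.and (.get 2 (.reg 2)) (.ne (.reg 4) (.reg 2)))
    (.seq (.assign 6 (.get 1 (.reg 4))) (.seq (.assign 7 (.get 2 (.reg 2)))
      (.seq mulProg (.store 1 (.reg 4) (.reg 8))))) .noop))

/-- The factor by which entry `q` of array `2` changes entry `m` of array `1`. -/
def factor (d : ℕ → ℕ) (m q : ℕ) : ℕ := if d q = 0 ∨ m = q then 1 else d q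

/-- The multiplier in register `7` is always an original entry of array `2`, so the growth of array
`1` does not affect the number of iterations. -/
theorem runs_scaleProg {M : ℕ} {s : State} (hM : s.reg 1 ≤ M)
    (hM' : ∀ q < s.reg 1, (s.arr 2 q).size ≤ M) :
    Runs M scaleProg s fun s' => ∀ m < s.reg 1,
      s'.arr 1 m = s.arr 1 m * ∏ q ∈ Finset.range (s.reg 1), factor (s.arr 2) m q := by
  refine .mono (.forLoop (by decide) (by decide) (by decide) (by decide)
    (fun i s' => ∀ m < s.reg 1,
      s'.arr 1 m = s.arr 1 m * ∏ q ∈ Finset.range i, factor (s.arr 2) m q) hM ?_ ?_)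
    fun s' _ h => h.1
  · intro s' h _ m _
    simp [h]
  · intro i hi s₁ hf₁ h2 _ hI
    have r1 : s₁.reg 1 = s.reg 1 := hf₁.1 1 rfl
    have a2 : s₁.arr 2 = s.arr 2 := hf₁.2 2 rfl
    refine .mono (.forLoop (by decide) (by decide) (by decide) (by decide)
      (fun j s' => ∀ m < s.reg 1,
        s'.arr 1 m = s₁.arr 1 m * if m < j then factor (s.arr 2) m i else 1)
      (r1 ▸ hM) ?_ ?_) ?_
    · intro s' h _ m _
      simp [h]
    · intro j hj s₂ hf₂ h4 _ hJ
      have r2 : s₂.reg 2 = i := (hf₂.1 2 rfl).trans h2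
      have b2 : s₂.arr 2 = s.arr 2 := (hf₂.2 2 rfl).trans a2
      refine .ite (fun he => ?_) fun he => .noop ?_
      · simp only [ne_eq, Expr.eval_and, Expr.eval_ne, Expr.eval, not_not, r2, h4, b2] at he
        refine .seq (.assign (.seq (.assign (.seq (.mono (runs_mulProg ?_) ?_)))))
        · simpa [Expr.eval, r2, b2] using hM' i hi
        · intro s₃ hf₃ h8
          refine .store ?_
          have a1 : s₃.arr 1 = s₂.arr 1 := hf₃.2 1 rfl
          have e4 : s₃.reg 4 = j := (hf₃.1 4 rfl).trans h4
          intro m hm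
          have h₁ := hJ m hm
          simp only [State.setReg_reg, Expr.eval] at h8
          norm_num at h8
          rw [h4, r2, b2, hJ j (r1 ▸ hj), if_neg (lt_irrefl j)] at h8
          simp only [State.setReg_arr, State.setArr_arr, Expr.eval, e4, a1, if_true,
            Function.update_apply]
          by_cases hmj : m = j
          · subst hmj
            rw [if_pos rfl, if_pos (Nat.lt_succ_self _), factor, if_neg (not_or.2 he), h8, mul_one]
          · rw [if_neg hmj, h₁]
            congr 1
            exact if_congr (by omega) rfl rfl
      · simp only [ne_eq, Expr.eval_and, Expr.eval_ne, Expr.eval, r2, h4, b2] at he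
        intro m hm
        rw [State.setReg_arr, State.setReg_arr, hJ m hm]
        congr 1
        by_cases hmj : m = j
        · subst hmj
          rw [if_neg (lt_irrefl m), if_pos (Nat.lt_succ_self _), factor, if_pos]
          by_contra h
          exact he (not_or.1 h)
        · exact if_congr (by omega) rfl rfl
    · rintro s₂ - ⟨h, -⟩ m hm
      rw [State.setReg_arr, State.setReg_arr, h m hm, if_pos (r1 ▸ hm), hI m hm,
        Finset.prod_range_succ, mul_assoc]

/-! ### Matrix addressing and the computation of ranks and weights. -/

/-- The contribution of the indices below `i` to a sum. -/
def partialSum {n : ℕ} (f : Fin n → ℕ) (i : ℕ) : ℕ := ∑ t : Fin n, if t.val < i then f t else 0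

@[simp] theorem partialSum_zero {n : ℕ} (f : Fin n → ℕ) : partialSum f 0 = 0 := by
  simp [partialSum]

theorem partialSum_succ {n : ℕ} (f : Fin n → ℕ) (v : Fin n) :
    partialSum f (v + 1) = partialSum f v + f v := by
  have : f v = ∑ t : Fin n, if t = v then f t else 0 := by simp
  rw [partialSum, partialSum, this, ← Finset.sum_add_distrib]
  refine Finset.sum_congr rfl fun t _ => ?_
  by_cases h : t = v
  · simp [h]
  · have : t.val ≠ v.val := fun h' => h (Fin.ext h')
    simp only [h, if_false, add_zero]
    exact if_congr (by omega) rfl rfl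

theorem partialSum_self {n : ℕ} (f : Fin n → ℕ) : partialSum f n = ∑ t, f t := by
  simp [partialSum]

theorem index_inj {n : ℕ} (i j v u : Fin n) :
    (i : ℕ) * n + j = v * n + u ↔ i = v ∧ j = u := by
  have h := finProdFinEquiv.injective.eq_iff (a := (i, j)) (b := (v, u))
  rw [Fin.ext_iff] at h
  simpa [finProdFinEquiv, add_comm, mul_comm] using h

theorem update_index {n : ℕ} (f : ℕ → ℕ) (v u i j : Fin n) (w : ℕ) :
    Function.update f ((v : ℕ) * n + u) w (i * n + j) =
      if i = v ∧ j = u then w else f (i * n + j) := by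
  rw [Function.update_apply]
  exact if_congr (index_inj i j v u) rfl rfl

/-- The memory holds the graph `N`. -/
structure Holds {n : ℕ} (N : CostGraph n) (s : State) : Prop where
  size : s.reg 0 = n
  req : ∀ i : Fin n, s.arr 0 i = N.req i
  cost : ∀ i j : Fin n, s.arr 1 (i * n + j) = N.cost i j
  adj : ∀ i j : Fin n, s.arr 2 (i * n + j) = 0 ↔ ¬ N.adj i j

theorem Holds.congr {n : ℕ} {N : CostGraph n} {s s' : State} (h : Holds N s)
    (h₀ : s'.reg 0 = s.reg 0) (ha₀ : s'.arr 0 = s.arr 0) (ha₁ : s'.arr 1 = s.arr 1)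
    (ha₂ : s'.arr 2 = s.arr 2) : Holds N s' :=
  ⟨h₀.trans h.size, by rw [ha₀]; exact h.req, by rw [ha₁]; exact h.cost, by rw [ha₂]; exact h.adj⟩

/-- The memory holds the graph `N`, the ranks of its edges and the weights of its nodes. -/
structure Ranked {n : ℕ} (N : CostGraph n) (s : State) : Prop extends Holds N s where
  rank : ∀ i j : Fin n, s.arr 4 (i * n + j) = N.rank i j
  weight : ∀ i : Fin n, s.arr 5 i = N.weight i

theorem Ranked.congr {n : ℕ} {N : CostGraph n} {s s' : State} (h : Ranked N s)
    (h₀ : s'.reg 0 = s.reg 0) (ha₀ : s'.arr 0 = s.arr 0) (ha₁ : s'.arr 1 = s.arr 1)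
    (ha₂ : s'.arr 2 = s.arr 2) (ha₄ : s'.arr 4 = s.arr 4) (ha₅ : s'.arr 5 = s.arr 5) :
    Ranked N s' :=
  ⟨h.toHolds.congr h₀ ha₀ ha₁ ha₂, by rw [ha₄]; exact h.rank, by rw [ha₅]; exact h.weight⟩

/-- Computation of the ranks (array `4`) and the weights (array `5`). -/
def rankProg : Program :=
  forLoop 0 10 11 (forLoop 0 12 13 (.seq (.assign 16 (.lit 0)) (.seq
    (forLoop 0 14 15 (.ite (.and (.get 2 (.add (.reg 11) (.reg 14)))
      (.add (.lt (.get 1 (.add (.reg 11) (.reg 14))) (.get 1 (.add (.reg 11) (.reg 12))))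
        (.and (.not (.lt (.get 1 (.add (.reg 11) (.reg 12))) (.get 1 (.add (.reg 11) (.reg 14)))))
          (.lt (.reg 14) (.reg 12))))) (.assign 16 (.add (.reg 16) (.lit 1))) .noop))
    (.seq (.store 4 (.add (.reg 11) (.reg 12)) (.reg 16))
      (.ite (.and (.get 2 (.add (.reg 11) (.reg 12)))
          (.not (.ne (.add (.reg 16) (.lit 1)) (.get 0 (.reg 10)))))
        (.store 5 (.reg 10) (.add (.get 5 (.reg 10)) (.get 1 (.add (.reg 11) (.reg 12)))))
        .noop)))))

open scoped Classical in
theorem runs_rankProg {n M : ℕ} {N : CostGraph n} {s : State} (hs : Holds N s) (hM : n ≤ M)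
    (h5 : ∀ i, s.arr 5 i = 0) : Runs M rankProg s (Ranked N) := by
  have hM : s.reg 0 ≤ M := hs.size ▸ hM
  -- These are the summands of `weight`. Array `5` accumulates them and must therefore start at
  -- zero.
  let f : Fin n → Fin n → ℕ := fun v u =>
    if N.adj v u ∧ N.rank v u + 1 = N.req v then N.cost v u else 0
  refine .mono (.forLoop (by decide) (by decide) (by decide) (by decide)
    (fun i s' => (∀ v u : Fin n, v.val < i → s'.arr 4 (v * n + u) = N.rank v u) ∧
      ∀ v : Fin n, s'.arr 5 v = if v.val < i then N.weight v else 0) hM ?_ ?_) ?_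
  · intro s' h _
    simp [h, h5]
  · intro i hi s₁ hf₁ r10 r11 ⟨hI₁, hI₂⟩
    have r0 : s₁.reg 0 = n := (hf₁.1 0 rfl).trans hs.size
    have hs₁ : Holds N s₁ := hs.congr (hf₁.1 0 rfl) (hf₁.2 0 rfl) (hf₁.2 1 rfl) (hf₁.2 2 rfl)
    rw [hs.size] at hi r11
    obtain ⟨v, rfl⟩ : ∃ v : Fin n, v.val = i := ⟨⟨i, hi⟩, rfl⟩
    refine .mono (.forLoop (by decide) (by decide) (by decide) (by decide)
      (fun j s' => (∀ a u : Fin n, a.val < v ∨ a = v ∧ u.val < j →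
        s'.arr 4 (a * n + u) = N.rank a u) ∧
        ∀ a : Fin n, s'.arr 5 a = if a.val < v then N.weight a else
          if a = v then partialSum (f v) j else 0) (by omega) ?_ ?_) ?_
    · intro s' h _
      refine ⟨fun a u h' => ?_, fun a => ?_⟩
      · rw [h]; exact hI₁ a u (by omega)
      · rw [h, hI₂]; simp
    · intro j hj s₂ hf₂ r12 r13 ⟨hJ₁, hJ₂⟩
      have hs₂ : Holds N s₂ := hs₁.congr (hf₂.1 0 rfl) (hf₂.2 0 rfl) (hf₂.2 1 rfl) (hf₂.2 2 rfl)
      rw [r0] at hj r13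
      obtain ⟨u, rfl⟩ : ∃ u : Fin n, u.val = j := ⟨⟨j, hj⟩, rfl⟩
      have p10 : s₂.reg 10 = v := (hf₂.1 10 rfl).trans r10
      have p11 : s₂.reg 11 = v * n := (hf₂.1 11 rfl).trans r11
      refine .seq (.assign (.seq (.mono (.forLoop (by decide) (by decide) (by decide) (by decide)
        (fun k s' => s'.reg 16 = partialSum (fun t => if N.adj v t ∧ (N.cost v t < N.cost v u ∨
          N.cost v t ≤ N.cost v u ∧ t < u) then 1 else 0) k) ?_ ?_ ?_) ?_)))
      · simp [hs₂.size]; omega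
      · intro s' _ h
        rw [h 16 (by decide) (by decide)]
        simp [Expr.eval]
      · intro k hk s₃ hf₃ r14 _ hK
        have hs₃ : Holds N s₃ := hs₂.congr (hf₃.1 0 rfl) (hf₃.2 0 rfl) (hf₃.2 1 rfl) (hf₃.2 2 rfl)
        have q11 : s₃.reg 11 = v * n := (hf₃.1 11 rfl).trans p11
        have q12 : s₃.reg 12 = u := (hf₃.1 12 rfl).trans r12
        have q0 : k < n := by simpa [hs₂.size] using hk
        obtain ⟨t, rfl⟩ : ∃ t : Fin n, t.val = k := ⟨⟨k, q0⟩, rfl⟩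
        have hcond := partialSum_succ (fun t => if N.adj v t ∧ (N.cost v t < N.cost v u ∨
          N.cost v t ≤ N.cost v u ∧ t < u) then 1 else 0) t
        refine .ite (fun he => .assign ?_) fun he => .noop ?_ <;>
        · simp only [ne_eq, Expr.eval_and, Expr.eval, Nat.add_eq_zero_iff, Expr.eval_lt,
            Expr.eval_not, q11, q12, r14, hs₃.cost, hs₃.adj, not_not, not_and_or, not_lt,
            ← Fin.lt_def] at he
          simp only [State.setReg_reg, Expr.eval]
          norm_num
          rw [hK, hcond]
          simp only [add_right_inj, left_eq_add]
          first
          | rw [if_pos]; grind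
          | rw [if_neg]; grind
      · rintro s₃ hf₃ ⟨hK, -⟩
        have hs₃ : Holds N s₃ := hs₂.congr (hf₃.1 0 rfl) (hf₃.2 0 rfl) (hf₃.2 1 rfl) (hf₃.2 2 rfl)
        have q10 : s₃.reg 10 = v := (hf₃.1 10 rfl).trans p10
        have q11 : s₃.reg 11 = v * n := (hf₃.1 11 rfl).trans p11
        have q12 : s₃.reg 12 = u := (hf₃.1 12 rfl).trans r12
        have q4 : s₃.arr 4 = s₂.arr 4 := hf₃.2 4 rfl
        have q5 : s₃.arr 5 = s₂.arr 5 := hf₃.2 5 rfl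
        have hrank : s₃.reg 16 = N.rank v u := by
          rw [hK]
          simp only [State.setReg_reg, hs₂.size]
          norm_num
          rw [partialSum_self, CostGraph.rank, Finset.card_filter]
        refine .seq (.store ?_)
        have h4 : ∀ a b : Fin n, a.val < v ∨ a = v ∧ b.val < u + 1 →
            Function.update (s₂.arr 4) (v * n + u) (N.rank v u) (a * n + b) = N.rank a b := by
          intro a b hab
          rw [update_index]
          split_ifs with h
          · rw [h.1, h.2]
          · refine hJ₁ a b (hab.imp id fun h' => ⟨h'.1, ?_⟩)
            have : b.val ≠ u.val := fun h'' => h ⟨h'.1, Fin.ext h''⟩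
            omega
        refine .ite (fun he => .store ?_) fun he => .noop ?_
        · simp only [ne_eq, Expr.eval_and, Expr.eval, Expr.eval_not, Expr.eval_ne,
            State.setArr_reg, State.setArr_arr, q10, q11, q12, hrank] at he
          norm_num [hs₃.adj, hs₃.req] at he
          simp only [State.setReg_arr, State.setArr_arr, State.setArr_reg, Expr.eval, q10, q11,
            q12, hrank, q4, q5]
          norm_num
          refine ⟨fun a b h => h4 a b (h.imp id fun h => ⟨h.1, Nat.lt_succ_of_le h.2⟩), fun a => ?_⟩
          rw [Function.update_apply, hJ₂, hJ₂, hs₃.cost]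
          simp only [Fin.val_inj]
          by_cases hav : a = v
          · subst hav
            simp [partialSum_succ, f, he]
          · simp [hav]
        · simp only [ne_eq, Expr.eval_and, Expr.eval, Expr.eval_not, Expr.eval_ne,
            State.setArr_reg, State.setArr_arr, q10, q11, q12, hrank] at he
          norm_num [hs₃.adj, hs₃.req] at he
          simp only [State.setReg_arr, State.setArr_arr, Expr.eval, q11, q12, hrank, q4, q5]
          norm_num
          refine ⟨fun a b h => h4 a b (h.imp id fun h => ⟨h.1, Nat.lt_succ_of_le h.2⟩), fun a => ?_⟩
          rw [hJ₂]
          by_cases hav : a = v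
          · subst hav
            have : f a u = 0 := if_neg fun h => he h.1 h.2
            simp [partialSum_succ, this]
          · simp [hav]
    · rintro s₂ - ⟨⟨h₁, h₂⟩, -⟩
      refine ⟨fun a u ha => ?_, fun a => ?_⟩
      · rw [State.setReg_arr, State.setReg_arr]
        refine h₁ a u ?_
        have := u.isLt
        rcases Nat.lt_succ_iff_lt_or_eq.1 ha with h | h
        · exact .inl h
        · exact .inr ⟨Fin.ext h, by omega⟩
      · rw [State.setReg_arr, State.setReg_arr, h₂ a, r0, partialSum_self]
        by_cases hav : a = v
        · subst hav
          simp [f, CostGraph.weight]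
        · have : a.val ≠ v.val := fun h => hav (Fin.ext h)
          simp only [hav, if_false]
          exact if_congr (by omega) rfl rfl
  · rintro s' hf ⟨⟨h₁, h₂⟩, -⟩
    rw [hs.size] at h₁ h₂
    exact ⟨hs.congr (hf.1 0 rfl) (hf.2 0 rfl) (hf.2 1 rfl) (hf.2 2 rfl),
      fun i j => h₁ i j i.isLt, fun i => by rw [h₂, if_pos i.isLt]⟩

end RAM

/-! ### The star pass and the final choice on the machine. -/

namespace RAM

open scoped Classical

/-- The test that the edge at the node in register `v` to the node in register `u` is not among the
`req - 1` cheapest ones; register `b` holds the offset of the row of `v`. -/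
def outsideExpr (v b u : ℕ) : Expr :=
  .not (.lt (.add (.get 4 (.add (.reg b) (.reg u))) (.lit 1)) (.get 0 (.reg v)))

/-- The cost of the edge between the center and the node in register `u`. -/
def costExpr (u : ℕ) : Expr := .get 1 (.add (.reg 11) (.reg u))

/-- The test that the node in register `14` belongs to the star. -/
def leafExpr : Expr :=
  .and (.get 2 (.add (.reg 11) (.reg 14))) (.and (.not (.get 6 (.reg 14)))
    (.and (outsideExpr 14 15 10) (.add (.not (.ne (.reg 14) (.reg 12)))
      (.and (.not (.lt (.reg 19) (costExpr 14)))
        (.lt (.add (costExpr 14) (costExpr 14))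
          (.add (.get 5 (.reg 14)) (.add (.get 5 (.reg 14)) (.get 5 (.reg 14)))))))))

/-- Computation of the gain (register `17`) and the price (register `18`) of a star. -/
def evalProg : Program :=
  .seq (.assign 19 (.add (.get 5 (.reg 10)) (.sub (costExpr 12) (.get 5 (.reg 10)))))
    (.seq (.assign 17 (.lit 0))
    (.seq (.assign 18 (.add (.sub (.reg 19) (.get 5 (.reg 10)))
      (.sub (.reg 19) (.get 5 (.reg 10)))))
    (.seq (forLoop 0 14 15 (.ite leafExpr
      (.seq (.assign 17 (.add (.reg 17) (.get 5 (.reg 14))))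
        (.assign 18 (.add (.reg 18) (.add (.sub (costExpr 14) (.get 5 (.reg 14)))
          (.sub (costExpr 14) (.get 5 (.reg 14))))))) .noop))
    (.ite (.and (.not (.get 6 (.reg 10))) (outsideExpr 10 11 12))
      (.assign 17 (.add (.reg 17) (.get 5 (.reg 10)))) .noop))))

/-- Selection of the edges of a star (array `3`) and marking of the nodes that it covers
(array `6`). -/
def selectProg : Program :=
  .seq (forLoop 0 14 15 (.ite leafExpr
      (.seq (.store 3 (.add (.reg 11) (.reg 14)) (.lit 1)) (.store 6 (.reg 14) (.lit 1))) .noop))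
    (.ite (outsideExpr 10 11 12) (.store 6 (.reg 10) (.lit 1)) .noop)

/-- The pass over the stars. -/
def starProg : Program :=
  forLoop 0 10 11 (forLoop 0 12 13 (.ite
    (.and (.get 2 (.add (.reg 11) (.reg 12)))
      (.and (.not (.get 6 (.reg 12))) (outsideExpr 12 13 10)))
    (.seq evalProg (.ite (.lt (.reg 18) (.reg 17)) selectProg .noop)) .noop))

/-- The final choice of edges by the nodes. -/
def chooseProg : Program :=
  forLoop 0 10 11 (forLoop 0 12 13 (.ite
    (.and (.get 2 (.add (.reg 11) (.reg 12)))
      (.add (.not (outsideExpr 10 11 12)) (.and (.not (.get 6 (.reg 10)))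
        (.lt (.get 4 (.add (.reg 11) (.reg 12))) (.get 0 (.reg 10))))))
    (.store 3 (.add (.reg 11) (.reg 12)) (.lit 1)) .noop))

variable {n M : ℕ} {N : CostGraph n} {s : State}

theorem outsideExpr_eval (hs : Ranked N s) {v b u : ℕ} {i j : Fin n} (hv : s.reg v = i)
    (hb : s.reg b = i * n) (hu : s.reg u = j) :
    (outsideExpr v b u).eval s = 0 ↔ ¬ N.Outside i j := by
  simp [outsideExpr, Expr.eval, hv, hb, hu, hs.rank, hs.req, CostGraph.Outside]

/-- The registers point at the star of center `v` and last leaf `y`. -/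
structure AtStar (N : CostGraph n) (v y : Fin n) (s : State) : Prop extends Ranked N s where
  center : s.reg 10 = v
  row : s.reg 11 = v * n
  leaf : s.reg 12 = y

theorem AtStar.congr {v y : Fin n} {s s' : State} (h : AtStar N v y s)
    (h₀ : s'.reg 0 = s.reg 0) (h₁ : s'.reg 10 = s.reg 10) (h₂ : s'.reg 11 = s.reg 11)
    (h₃ : s'.reg 12 = s.reg 12) (ha₀ : s'.arr 0 = s.arr 0) (ha₁ : s'.arr 1 = s.arr 1)
    (ha₂ : s'.arr 2 = s.arr 2) (ha₄ : s'.arr 4 = s.arr 4) (ha₅ : s'.arr 5 = s.arr 5) :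
    AtStar N v y s' :=
  ⟨h.toRanked.congr h₀ ha₀ ha₁ ha₂ ha₄ ha₅, h₁.trans h.center, h₂.trans h.row, h₃.trans h.leaf⟩

theorem AtStar.costExpr_eval {v y u : Fin n} (hs : AtStar N v y s) {x : ℕ} (hx : s.reg x = u) :
    (costExpr x).eval s = N.cost v u := by
  simp [costExpr, Expr.eval, hs.row, hx, hs.cost]

/-- A sum of tests acts as a disjunction. Array `6` is constrained only at `u` itself, because
`selectProg` overwrites other cells while this test is still in use. -/
theorem AtStar.leafExpr_eval {v y u : Fin n} {c : Fin n → Prop} (hs : AtStar N v y s)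
    (hX : s.reg 19 = max (N.cost v y) (N.weight v)) (hc : s.arr 6 u = 0 ↔ ¬ c u)
    (hu : s.reg 14 = u) (hb : s.reg 15 = u * n) :
    leafExpr.eval s = 0 ↔ u ∉ N.starSet c v y := by
  rw [CostGraph.mem_starSet]
  simp only [leafExpr, ne_eq, Expr.eval_and, Expr.eval_not, Expr.eval_ne, Expr.eval_lt,
    outsideExpr_eval hs.toRanked hu hb hs.center, hs.costExpr_eval hu, Expr.eval,
    Nat.add_eq_zero_iff, hu, hs.row, hs.leaf, hs.adj, hs.weight, hc, hX, Fin.val_inj]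
  have e : 3 * N.weight u = N.weight u + (N.weight u + N.weight u) := by ring
  rw [e, two_mul]
  simp only [not_and_or, not_or, not_not, not_lt, not_le]

theorem runs_evalProg {v y : Fin n} {c : Fin n → Prop} (hs : AtStar N v y s) (hM : n ≤ M)
    (hc : ∀ u : Fin n, s.arr 6 u = 0 ↔ ¬ c u) :
    Runs M evalProg s fun s' => s'.reg 17 = N.gain c v y ∧ s'.reg 18 = N.price c v y ∧
      s'.reg 19 = max (N.cost v y) (N.weight v) := by
  -- With truncated subtraction, w + (c - w) is the maximum of c and w.
  have hmax : (Expr.add (.get 5 (.reg 10)) (.sub (costExpr 12) (.get 5 (.reg 10)))).eval s =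
      max (N.cost v y) (N.weight v) := by
    simp only [Expr.eval, hs.costExpr_eval hs.leaf, hs.center, hs.weight]
    omega
  refine .seq (.assign (.seq (.assign (.seq (.assign ?_)))))
  rw [hmax]
  refine .seq (.mono (.forLoop (by decide) (by decide) (by decide) (by decide)
    (fun i s' => s'.reg 17 =
        partialSum (fun u => if u ∈ N.starSet c v y then N.weight u else 0) i ∧
      s'.reg 18 = 2 * (max (N.cost v y) (N.weight v) - N.weight v) +
        partialSum (fun u => if u ∈ N.starSet c v y then
          2 * (N.cost v u - N.weight u) else 0) i) ?_ ?_ ?_) ?_)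
  · simpa [hs.size] using hM
  · intro s' _ h
    rw [h 17 (by decide) (by decide), h 18 (by decide) (by decide)]
    simp [Expr.eval, hs.center, hs.weight, two_mul]
  · intro i hi s₁ hf r14 r15 ⟨h₁, h₂⟩
    have r0 : i < n := by simpa [hs.size] using hi
    obtain ⟨u, rfl⟩ : ∃ u : Fin n, u.val = i := ⟨⟨i, r0⟩, rfl⟩
    have hs₁ : AtStar N v y s₁ := hs.congr (hf.1 0 rfl) (hf.1 10 rfl) (hf.1 11 rfl) (hf.1 12 rfl)
      (hf.2 0 rfl) (hf.2 1 rfl) (hf.2 2 rfl) (hf.2 4 rfl) (hf.2 5 rfl)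
    have a6 : s₁.arr 6 = s.arr 6 := hf.2 6 rfl
    have hl := hs₁.leafExpr_eval (c := c) (hf.1 19 rfl) (by rw [a6]; exact hc u) r14
      (by simpa [hs.size] using r15)
    refine .ite (fun he => .seq (.assign (.assign ?_))) fun he => .noop ?_
    · have hu : u ∈ N.starSet c v y := not_not.1 (mt hl.2 he)
      have e₁ := hs₁.costExpr_eval r14
      simp only [costExpr, Expr.eval] at e₁
      simp only [costExpr, Expr.eval, State.setReg_reg, State.setReg_arr, partialSum_succ, hu]
      norm_num
      rw [e₁, h₁, h₂, r14, hs₁.weight]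
      omega
    · simp only [State.setReg_reg, partialSum_succ, hl.1 he]
      norm_num
      exact ⟨h₁, h₂⟩
  · rintro s₁ hf ⟨⟨h₁, h₂⟩, -⟩
    have hs₁ : AtStar N v y s₁ := hs.congr (hf.1 0 rfl) (hf.1 10 rfl) (hf.1 11 rfl) (hf.1 12 rfl)
      (hf.2 0 rfl) (hf.2 1 rfl) (hf.2 2 rfl) (hf.2 4 rfl) (hf.2 5 rfl)
    have a6 : s₁.arr 6 = s.arr 6 := hf.2 6 rfl
    have r19 : s₁.reg 19 = max (N.cost v y) (N.weight v) := hf.1 19 rfl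
    have r0 : (((s.setReg 19 (max (N.cost v y) (N.weight v))).setReg 17
        ((Expr.lit 0).eval (s.setReg 19 (max (N.cost v y) (N.weight v))))).setReg 18
        ((Expr.add (.sub (.reg 19) (.get 5 (.reg 10))) (.sub (.reg 19) (.get 5 (.reg 10)))).eval
          ((s.setReg 19 (max (N.cost v y) (N.weight v))).setReg 17
        ((Expr.lit 0).eval (s.setReg 19 (max (N.cost v y) (N.weight v))))))).reg 0 = n := by
      simp [hs.size]
    rw [r0, partialSum_self, Finset.sum_ite_mem_eq] at h₁ h₂
    have ho := outsideExpr_eval hs₁.toRanked hs₁.center hs₁.row hs₁.leaf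
    have hcond : (Expr.and (.not (.get 6 (.reg 10))) (outsideExpr 10 11 12)).eval s₁ = 0 ↔
        ¬ (¬ c v ∧ N.Outside v y) := by
      simp only [ne_eq, Expr.eval_and, Expr.eval_not, ho, Expr.eval, hs₁.center, a6, hc]
      tauto
    refine .ite (fun he => .assign ?_) fun he => .noop ?_
    · simp only [State.setReg_reg, Expr.eval, hs₁.center, hs₁.weight, CostGraph.gain,
        CostGraph.price]
      rw [if_pos (not_not.1 (mt hcond.2 he))]
      norm_num [h₁, h₂, r19]
    · rw [CostGraph.gain, if_neg (hcond.1 he)]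
      exact ⟨h₁, h₂, r19⟩

theorem runs_selectProg {v y : Fin n} {c : Fin n → Prop} {J : Fin n → Fin n → Prop}
    (hs : AtStar N v y s) (hM : n ≤ M) (hX : s.reg 19 = max (N.cost v y) (N.weight v))
    (hJ : ∀ i j : Fin n, s.arr 3 (i * n + j) = 0 ↔ ¬ J i j)
    (hc : ∀ u : Fin n, s.arr 6 u = 0 ↔ ¬ c u) :
    Runs M selectProg s fun s' =>
      (∀ i j : Fin n, s'.arr 3 (i * n + j) = 0 ↔ ¬ (J i j ∨ i = v ∧ j ∈ N.starSet c v y)) ∧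
      ∀ u : Fin n, s'.arr 6 u = 0 ↔
        ¬ (c u ∨ u ∈ N.starSet c v y ∨ u = v ∧ N.Outside v y) := by
  refine .seq (.mono (.forLoop (by decide) (by decide) (by decide) (by decide)
    (fun k s' => (∀ i j : Fin n, s'.arr 3 (i * n + j) = 0 ↔
      ¬ (J i j ∨ i = v ∧ j.val < k ∧ j ∈ N.starSet c v y)) ∧
      ∀ u : Fin n, s'.arr 6 u = 0 ↔ ¬ (c u ∨ u.val < k ∧ u ∈ N.starSet c v y)) ?_ ?_ ?_) ?_)
  · rw [hs.size]; exact hM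
  · intro s' h _
    rw [h]
    simpa using ⟨hJ, hc⟩
  · intro i hi s₁ hf r14 r15 ⟨h₁, h₂⟩
    rw [hs.size] at hi r15
    obtain ⟨u, rfl⟩ : ∃ u : Fin n, u.val = i := ⟨⟨i, hi⟩, rfl⟩
    have hs₁ : AtStar N v y s₁ := hs.congr (hf.1 0 rfl) (hf.1 10 rfl) (hf.1 11 rfl) (hf.1 12 rfl)
      (hf.2 0 rfl) (hf.2 1 rfl) (hf.2 2 rfl) (hf.2 4 rfl) (hf.2 5 rfl)
    -- Only cells of leaves below `u` have been marked so far, so cell `u` of array `6` still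
    -- describes the old `c`.
    have hl := hs₁.leafExpr_eval (c := c) (u := u) ((hf.1 19 rfl).trans hX) (by simp [h₂])
      r14 r15
    have hlt : ∀ j : Fin n, j.val < u + 1 ↔ j.val < u ∨ j = u := fun j => by
      rw [Nat.lt_succ_iff_lt_or_eq, Fin.val_inj]
    refine .ite (fun he => .seq (.store (.store ?_))) fun he => .noop ?_
    · have hu : u ∈ N.starSet c v y := not_not.1 (mt hl.2 he)
      simp only [State.setReg_arr, State.setArr_arr, State.setArr_reg, Expr.eval, r14, hs₁.row]
      norm_num only [if_true, if_false]
      refine ⟨fun a b => ?_, fun a => ?_⟩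
      · rw [update_index, hlt]
        split_ifs with hab
        · simp [hab.1, hab.2, hu]
        · rw [h₁]
          by_cases hb : b = u
          · have : a ≠ v := fun ha => hab ⟨ha, hb⟩
            simp [this]
          · simp [hb]
      · rw [Function.update_apply, hlt]
        split_ifs with ha
        · have ha : a = u := Fin.ext ha
          simp [ha, hu]
        · have ha : a ≠ u := fun h => ha (congrArg _ h)
          rw [h₂]
          simp [ha]
    · have hu : u ∉ N.starSet c v y := hl.1 he
      simp only [State.setReg_arr]
      have : ∀ j : Fin n, (j.val < u + 1 ∧ j ∈ N.starSet c v y) ↔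
          (j.val < u ∧ j ∈ N.starSet c v y) := fun j => by
        rw [hlt, or_and_right, or_iff_left]
        rintro ⟨rfl, h⟩
        exact hu h
      exact ⟨fun a b => by rw [this]; exact h₁ a b, fun a => by rw [this]; exact h₂ a⟩
  · rintro s₁ hf ⟨⟨h₁, h₂⟩, -⟩
    have hs₁ : AtStar N v y s₁ := hs.congr (hf.1 0 rfl) (hf.1 10 rfl) (hf.1 11 rfl) (hf.1 12 rfl)
      (hf.2 0 rfl) (hf.2 1 rfl) (hf.2 2 rfl) (hf.2 4 rfl) (hf.2 5 rfl)
    have ho := outsideExpr_eval hs₁.toRanked hs₁.center hs₁.row hs₁.leaf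
    rw [hs.size] at h₁ h₂
    simp only [Fin.is_lt, true_and] at h₁ h₂
    refine .ite (fun he => .store ?_) fun he => .noop ?_
    · have ho := not_not.1 (mt ho.2 he)
      simp only [State.setArr_arr, Expr.eval, hs₁.center]
      norm_num only [if_true, if_false]
      refine ⟨h₁, fun a => ?_⟩
      rw [Function.update_apply]
      split_ifs with ha
      · have ha : a = v := Fin.ext ha
        simp [ha, ho]
      · have ha : a ≠ v := fun h => ha (congrArg _ h)
        rw [h₂]
        simp [ha]
    · exact ⟨h₁, fun a => by simpa [ho.1 he] using h₂ a⟩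

/-- The arrays `3` and `6` hold a state of the pass over the stars. -/
def Tracks (N : CostGraph n) (seen : Fin n → Fin n → Prop) (s : State) : Prop :=
  ∃ J c, N.Progress J c seen ∧ (∀ i j : Fin n, s.arr 3 (i * n + j) = 0 ↔ ¬ J i j) ∧
    ∀ u : Fin n, s.arr 6 u = 0 ↔ ¬ c u

theorem Tracks.congr {seen seen' : Fin n → Fin n → Prop} {s s' : State} (h : Tracks N seen s)
    (hs : ∀ i j, seen' i j → seen i j) (h₃ : s'.arr 3 = s.arr 3) (h₆ : s'.arr 6 = s.arr 6) :
    Tracks N seen' s' := by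
  obtain ⟨J, c, h₁, h₂⟩ := h
  refine ⟨J, c, h₁.skip fun a b h => .inl (hs a b h), ?_⟩
  rw [h₃, h₆]
  exact h₂

/-- Pairs are seen in lexicographic order. If the first test fails, `NoStar` is vacuous; if the gain
does not exceed the price, `noStar_of_gain_le` applies; otherwise the star is selected. -/
theorem runs_starProg (hs : Ranked N s) (hM : n ≤ M) (h₃ : ∀ i, s.arr 3 i = 0)
    (h₆ : ∀ i, s.arr 6 i = 0) : Runs M starProg s (Tracks N fun _ _ => True) := by
  refine .mono (.forLoop (by decide) (by decide) (by decide) (by decide)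
    (fun i => Tracks N fun a _ => a.val < i) (by rw [hs.size]; exact hM) ?_ ?_) ?_
  · intro s' h _
    exact ⟨_, _, CostGraph.Progress.init.skip fun a b h => absurd h (Nat.not_lt_zero _),
      by simp [h, h₃], by simp [h, h₆]⟩
  · intro i hi s₁ hf₁ r10 r11 hI
    rw [hs.size] at hi r11
    obtain ⟨v, rfl⟩ : ∃ v : Fin n, v.val = i := ⟨⟨i, hi⟩, rfl⟩
    have hs₁ : Ranked N s₁ := hs.congr (hf₁.1 0 rfl) (hf₁.2 0 rfl) (hf₁.2 1 rfl) (hf₁.2 2 rfl)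
      (hf₁.2 4 rfl) (hf₁.2 5 rfl)
    refine .mono (.forLoop (by decide) (by decide) (by decide) (by decide)
      (fun j => Tracks N fun a b => a.val < v ∨ a = v ∧ b.val < j)
      (by rw [hs₁.size]; exact hM) ?_ ?_) ?_
    · intro s' h _
      exact hI.congr (fun a b h => by simpa using h) (by rw [h]) (by rw [h])
    · intro j hj s₂ hf₂ r12 r13 hJ
      rw [hs₁.size] at hj r13
      obtain ⟨y, rfl⟩ : ∃ y : Fin n, y.val = j := ⟨⟨j, hj⟩, rfl⟩
      have hs₂ : AtStar N v y s₂ := ⟨hs₁.congr (hf₂.1 0 rfl) (hf₂.2 0 rfl) (hf₂.2 1 rfl)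
        (hf₂.2 2 rfl) (hf₂.2 4 rfl) (hf₂.2 5 rfl), (hf₂.1 10 rfl).trans r10,
        (hf₂.1 11 rfl).trans r11, r12⟩
      obtain ⟨J, c, hP, h3, h6⟩ := hJ
      have hlt : ∀ a b : Fin n, (a.val < v ∨ a = v ∧ b.val < y + 1) →
          (a.val < v ∨ a = v ∧ b.val < y) ∨ a = v ∧ b = y := fun a b hab => by
        rw [Nat.lt_succ_iff_lt_or_eq, Fin.val_inj] at hab
        tauto
      have skip : N.NoStar c v y → N.Progress J c fun a b => a.val < v ∨ a = v ∧ b.val < y + 1 :=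
        fun hno => hP.skip fun a b hab => (hlt a b hab).imp id (by rintro ⟨rfl, rfl⟩; exact hno)
      have ho := outsideExpr_eval hs₂.toRanked r12 r13 hs₂.center
      have hcond : (Expr.and (.get 2 (.add (.reg 11) (.reg 12)))
          (.and (.not (.get 6 (.reg 12))) (outsideExpr 12 13 10))).eval s₂ = 0 ↔
          ¬ (N.adj v y ∧ ¬ c y ∧ N.Outside y v) := by
        simp only [ne_eq, Expr.eval_and, Expr.eval_not, ho, Expr.eval, hs₂.row, r12, hs₂.adj, h6]
        tauto
      refine .ite (fun he => .seq (.mono (runs_evalProg hs₂ hM h6) ?_)) fun he => .noop ?_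
      · obtain ⟨hadj, hcy, hoy⟩ := not_not.1 (mt hcond.2 he)
        rintro s₃ hf₃ ⟨hg, hp, hX⟩
        have hs₃ : AtStar N v y s₃ := hs₂.congr (hf₃.1 0 rfl) (hf₃.1 10 rfl) (hf₃.1 11 rfl)
          (hf₃.1 12 rfl) (hf₃.2 0 rfl) (hf₃.2 1 rfl) (hf₃.2 2 rfl) (hf₃.2 4 rfl) (hf₃.2 5 rfl)
        have a3 : s₃.arr 3 = s₂.arr 3 := hf₃.2 3 rfl
        have a6 : s₃.arr 6 = s₂.arr 6 := hf₃.2 6 rfl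
        refine .ite (fun he => .mono (runs_selectProg hs₃ hM hX (by rw [a3]; exact h3)
          (by rw [a6]; exact h6)) fun s₄ _ h => ?_) fun he => .noop ?_
        · rw [ne_eq, Expr.eval_lt, not_not, Expr.eval, Expr.eval, hg, hp] at he
          exact ⟨_, _, hP.select hadj hcy hoy he hlt, h⟩
        · rw [Expr.eval_lt, Expr.eval, Expr.eval, hg, hp, not_lt] at he
          refine ⟨J, c, skip (CostGraph.noStar_of_gain_le he), ?_⟩
          simp only [State.setReg_arr, a3, a6]
          exact ⟨h3, h6⟩
      · exact ⟨J, c, skip fun h₁ h₂ h₃ => absurd ⟨h₁, h₂, h₃⟩ (hcond.1 he), h3, h6⟩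
    · rintro s₂ - ⟨h, -⟩
      refine h.congr (fun a b hab => ?_) rfl rfl
      rw [Nat.lt_succ_iff_lt_or_eq, Fin.val_inj] at hab
      exact hab.imp id fun h => ⟨h, by rw [hs₁.size]; exact b.isLt⟩
  · rintro s' - ⟨h, -⟩
    exact h.congr (fun a b _ => by rw [hs.size]; exact a.isLt) rfl rfl

theorem runs_chooseProg {c : Fin n → Prop} {J : Fin n → Fin n → Prop} (hs : Ranked N s)
    (hM : n ≤ M) (h3 : ∀ i j : Fin n, s.arr 3 (i * n + j) = 0 ↔ ¬ J i j)
    (h6 : ∀ u : Fin n, s.arr 6 u = 0 ↔ ¬ c u) :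
    Runs M chooseProg s fun s' =>
      ∀ i j : Fin n, s'.arr 3 (i * n + j) = 0 ↔ ¬ (J i j ∨ N.Chosen c i j) := by
  refine .mono (.forLoop (by decide) (by decide) (by decide) (by decide)
    (fun k s' => ∀ i j : Fin n, s'.arr 3 (i * n + j) = 0 ↔ ¬ (J i j ∨ i.val < k ∧ N.Chosen c i j))
    (by rw [hs.size]; exact hM) ?_ ?_) ?_
  · intro s' h _
    simpa [h] using h3
  · intro i hi s₁ hf₁ r10 r11 hI
    rw [hs.size] at hi r11
    obtain ⟨v, rfl⟩ : ∃ v : Fin n, v.val = i := ⟨⟨i, hi⟩, rfl⟩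
    have hs₁ : Ranked N s₁ := hs.congr (hf₁.1 0 rfl) (hf₁.2 0 rfl) (hf₁.2 1 rfl) (hf₁.2 2 rfl)
      (hf₁.2 4 rfl) (hf₁.2 5 rfl)
    have a6 : s₁.arr 6 = s.arr 6 := hf₁.2 6 rfl
    refine .mono (.forLoop (by decide) (by decide) (by decide) (by decide)
      (fun k s' => ∀ i j : Fin n, s'.arr 3 (i * n + j) = 0 ↔
        ¬ (J i j ∨ (i.val < v ∨ i = v ∧ j.val < k) ∧ N.Chosen c i j))
      (by rw [hs₁.size]; exact hM) ?_ ?_) ?_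
    · intro s' h _
      simpa [h] using hI
    · intro j hj s₂ hf₂ r12 r13 hJ
      rw [hs₁.size] at hj r13
      obtain ⟨y, rfl⟩ : ∃ y : Fin n, y.val = j := ⟨⟨j, hj⟩, rfl⟩
      have hs₂ : AtStar N v y s₂ := ⟨hs₁.congr (hf₂.1 0 rfl) (hf₂.2 0 rfl) (hf₂.2 1 rfl)
        (hf₂.2 2 rfl) (hf₂.2 4 rfl) (hf₂.2 5 rfl), (hf₂.1 10 rfl).trans r10,
        (hf₂.1 11 rfl).trans r11, r12⟩
      have b6 : s₂.arr 6 = s.arr 6 := (hf₂.2 6 rfl).trans a6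
      have hlt : ∀ a b : Fin n, (a.val < v ∨ a = v ∧ b.val < y + 1) ↔
          (a.val < v ∨ a = v ∧ b.val < y) ∨ a = v ∧ b = y := fun a b => by
        rw [Nat.lt_succ_iff_lt_or_eq, Fin.val_inj]
        tauto
      have ho := outsideExpr_eval hs₂.toRanked hs₂.center hs₂.row r12
      have hcond : (Expr.and (.get 2 (.add (.reg 11) (.reg 12)))
          (.add (.not (outsideExpr 10 11 12)) (.and (.not (.get 6 (.reg 10)))
            (.lt (.get 4 (.add (.reg 11) (.reg 12))) (.get 0 (.reg 10)))))).eval s₂ = 0 ↔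
          ¬ N.Chosen c v y := by
        simp only [ne_eq, Expr.eval_and, Expr.eval_not, Expr.eval_lt, ho, Expr.eval, hs₂.row, r12,
          hs₂.adj, b6, h6, hs₂.center, hs₂.rank, hs₂.req, Nat.add_eq_zero_iff, CostGraph.Chosen,
          CostGraph.Outside, not_le]
        tauto
      refine .ite (fun he => .store ?_) fun he => .noop ?_
      · have hch := not_not.1 (mt hcond.2 he)
        simp only [State.setReg_arr, State.setArr_arr, Expr.eval, r12, hs₂.row, if_true]
        intro a b
        rw [update_index, hlt]
        split_ifs with hab
        · simp [hab.1, hab.2, hch]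
        · rw [hJ]
          simp [hab]
      · have hch := hcond.1 he
        intro a b
        rw [State.setReg_arr, State.setReg_arr, hJ, hlt]
        by_cases hab : a = v ∧ b = y
        · simp [hab.1, hab.2, hch]
        · simp [hab]
    · rintro s₂ - ⟨h, -⟩ a b
      rw [State.setReg_arr, State.setReg_arr, h, hs₁.size, Nat.lt_succ_iff_lt_or_eq, Fin.val_inj]
      simp
  · rintro s' - ⟨h, -⟩ a b
    rw [h, hs.size]
    simp

end RAM

/-! ### Clearing denominators, and assembly of the algorithm. -/

namespace MPEMC

open Finset RAM

variable (I : MPEMC)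

/-- The factor that makes all costs natural numbers: the product of all denominators. -/
noncomputable def scaleFactor : ℕ :=
  ∏ q ∈ range (I.n * I.n), if rowMajor I.den q = 0 then 1 else rowMajor I.den q

/-- The costs after scaling. -/
noncomputable def scaledCost (i j : Fin I.n) : ℕ :=
  I.num i j * ∏ q ∈ range (I.n * I.n), factor (rowMajor I.den) (i * I.n + j) q

variable {I}

theorem rowMajor_index {n : ℕ} (A : Fin n → Fin n → ℕ) (i j : Fin n) :
    rowMajor A (i * n + j) = A i j := by
  have h : (i : ℕ) * n + j = (finProdFinEquiv (i, j) : Fin (n * n)) := by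
    simp [finProdFinEquiv, add_comm, mul_comm]
  rw [rowMajor, dif_pos (by rw [h]; exact Fin.is_lt _)]
  simp only [h, Fin.eta, Equiv.symm_apply_apply]

theorem den_eq_zero {i j : Fin I.n} : I.den i j = 0 ↔ ¬ I.graph.Adj i j := by
  simp [den]

theorem scaleFactor_pos : 0 < I.scaleFactor :=
  prod_pos fun q _ => by split_ifs <;> omega

/-- `factor` omits exactly the denominator of the entry itself, so numerator times product is the
cost times the common factor, without any division. -/
theorem den_mul_prod {i j : Fin I.n} (h : I.graph.Adj i j) :
    (∏ q ∈ range (I.n * I.n), factor (rowMajor I.den) (i * I.n + j) q) * I.den i j =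
      I.scaleFactor := by
  have hm : (i : ℕ) * I.n + j < I.n * I.n := by
    have h : (i : ℕ) * I.n + j = (finProdFinEquiv (i, j) : Fin (I.n * I.n)) := by
      simp [finProdFinEquiv, add_comm, mul_comm]
    rw [h]
    exact Fin.is_lt _
  have hd : I.den i j = ∏ q ∈ range (I.n * I.n),
      if (i : ℕ) * I.n + j = q then rowMajor I.den q else 1 := by
    rw [prod_ite_eq, if_pos (mem_range.2 hm), rowMajor_index]
  rw [hd, ← prod_mul_distrib, scaleFactor]
  refine prod_congr rfl fun q _ => ?_
  by_cases hq : (i : ℕ) * I.n + j = q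
  · have : rowMajor I.den q ≠ 0 := by
      rw [← hq, rowMajor_index]
      exact fun h' => den_eq_zero.1 h' h
    simp [factor, hq, this]
  · simp [factor, hq]

theorem cast_scaledCost {i j : Fin I.n} (h : I.graph.Adj i j) :
    (I.scaledCost i j : ℚ≥0) = I.scaleFactor * I.cost s(i, j) := by
  have hnum : (I.num i j : ℚ≥0) = I.cost s(i, j) * I.den i j := by
    simp only [num, den, h, if_true]
    exact (NNRat.mul_den_eq_num _).symm
  rw [scaledCost, ← den_mul_prod h]
  push_cast
  rw [hnum]
  ring

/-- The entries `(i, j)` and `(j, i)` omit different positions of the product; on edges, both equal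
the common factor times the cost. -/
theorem scaledCost_symm (i j : Fin I.n) : I.scaledCost i j = I.scaledCost j i := by
  by_cases h : I.graph.Adj i j
  · have h' := cast_scaledCost h.symm
    rw [Sym2.eq_swap, ← cast_scaledCost h] at h'
    exact_mod_cast h'.symm
  · simp [scaledCost, num, h, I.graph.adj_comm j i]

variable (I) in
/-- The instance with scaled costs. -/
noncomputable def costGraph : CostGraph I.n where
  adj := I.graph.Adj
  adj_symm h := h.symm
  adj_irrefl v := I.graph.loopless.irrefl v
  cost := I.scaledCost
  cost_symm := scaledCost_symm
  req := I.req

/-- The approximation algorithm. -/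
def program : Program :=
  .seq (forLoop 0 2 1 .noop) (.seq scaleProg (.seq rankProg (.seq starProg chooseProg)))

theorem n_le_size : I.n ≤ I.size := by
  have h : ∑ v : Fin I.n, 1 ≤ ∑ v, ((I.req v).size + 1) :=
    sum_le_sum fun v _ => Nat.le_add_left _ _
  simp only [sum_const, card_univ, Fintype.card_fin, smul_eq_mul, mul_one] at h
  unfold size
  omega

theorem n_mul_n_le_size : I.n * I.n ≤ I.size := by
  have h : ∑ i : Fin I.n, ∑ j : Fin I.n, 1 ≤
      ∑ i, ∑ j, (((I.num i j).size + 1) + ((I.den i j).size + 1)) :=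
    sum_le_sum fun i _ => sum_le_sum fun j _ => by omega
  simp only [sum_const, card_univ, Fintype.card_fin, smul_eq_mul, mul_one] at h
  unfold size
  omega

theorem rowMajor_den_size_le (q : ℕ) : (rowMajor I.den q).size ≤ I.size := by
  unfold rowMajor
  split_ifs with h
  · generalize (finProdFinEquiv.symm ⟨q, h⟩ : Fin I.n × Fin I.n) = p
    have h₁ := single_le_sum
      (f := fun j => ((I.num p.1 j).size + 1) + ((I.den p.1 j).size + 1))
      (fun _ _ => Nat.zero_le _) (mem_univ p.2)
    have h₂ := single_le_sum
      (f := fun i => ∑ j, (((I.num i j).size + 1) + ((I.den i j).size + 1)))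
      (fun _ _ => Nat.zero_le _) (mem_univ p.1)
    unfold size
    omega
  · simp

/-- No cover is assumed to exist, since the algorithm must halt on every instance. `I.size` bounds
all loop counts: n, n² and the lengths of the denominators. -/
theorem runs_program (I : MPEMC) : Runs I.size program I.input fun s =>
    ∃ J c, I.costGraph.Progress J c (fun _ _ => True) ∧
      ∀ i j : Fin I.n, s.arr 3 (i * I.n + j) = 0 ↔ ¬ (J i j ∨ I.costGraph.Chosen c i j) := by
  have e0 : I.input.reg 0 = I.n := rfl
  -- The loop with empty body is run only to leave `n * n` in register `1`.
  refine .seq (.mono (.forLoop (by decide) (by decide) (by decide) (by decide)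
    (fun _ _ => True) n_le_size (fun _ _ _ => trivial) fun _ _ _ _ _ _ _ => .noop trivial) ?_)
  rintro s₁ hf₁ ⟨-, r1⟩
  rw [e0] at r1
  have a₁ : ∀ a, s₁.arr a = I.input.arr a := fun a => hf₁.2 a rfl
  refine .seq (.mono (runs_scaleProg (r1 ▸ n_mul_n_le_size) fun q _ => ?_) ?_)
  · rw [a₁]
    exact rowMajor_den_size_le q
  intro s₂ hf₂ hscale
  have a₂ : ∀ a, a ≠ 1 → s₂.arr a = I.input.arr a := fun a ha =>
    (hf₂.2 a (by simpa [scaleProg, forLoop, mulProg, Program.writesArr] using ha)).trans (a₁ a)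
  have hs₂ : Holds I.costGraph s₂ := by
    refine ⟨(hf₂.1 0 rfl).trans (hf₁.1 0 rfl), fun i => ?_, fun i j => ?_, fun i j => ?_⟩
    · rw [a₂ 0 (by decide)]
      simp [input, costGraph]
    · have hlt := (finProdFinEquiv (i, j)).isLt
      rw [hscale _ (by rw [r1]; simpa [finProdFinEquiv, add_comm, mul_comm] using hlt), a₁, a₁, r1]
      change rowMajor I.num _ * ∏ q ∈ range (I.n * I.n), factor (rowMajor I.den) _ q = _
      rw [rowMajor_index]
      rfl
    · rw [a₂ 2 (by decide)]
      change rowMajor I.den _ = 0 ↔ _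
      rw [rowMajor_index, den_eq_zero]
      rfl
  refine .seq (.mono (runs_rankProg hs₂ n_le_size fun i => by rw [a₂ 5 (by decide)]; rfl) ?_)
  intro s₃ hf₃ hs₃
  have z3 : s₃.arr 3 = I.input.arr 3 := (hf₃.2 3 rfl).trans (a₂ 3 (by decide))
  have z6 : s₃.arr 6 = I.input.arr 6 := (hf₃.2 6 rfl).trans (a₂ 6 (by decide))
  refine .seq (.mono (runs_starProg hs₃ n_le_size (fun i => by rw [z3]; rfl)
    fun i => by rw [z6]; rfl) ?_)
  rintro s₄ hf₄ ⟨J, c, hP, h3, h6⟩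
  have hs₄ := hs₃.congr (hf₄.1 0 rfl) (hf₄.2 0 rfl) (hf₄.2 1 rfl) (hf₄.2 2 rfl) (hf₄.2 4 rfl)
    (hf₄.2 5 rfl)
  exact .mono (runs_chooseProg hs₄ n_le_size h3 h6) fun s₅ _ h => ⟨J, c, hP, h⟩

open scoped Classical in
theorem IsCover.feasible {J : Finset (Sym2 (Fin I.n))} (hJ : I.IsCover J) :
    I.costGraph.Feasible fun u v => s(u, v) ∈ J where
  symm h := by rwa [Sym2.eq_swap]
  adj h := hJ.1 _ h
  le_card v := by
    refine (hJ.2 v).trans (le_trans (card_le_card fun e he => ?_)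
      (card_image_le (f := fun u => s(v, u))))
    obtain ⟨heJ, u, rfl⟩ := mem_filter.1 he
    exact mem_image_of_mem _ (by simpa using heJ)

theorem cost_le_nodePower {J : Finset (Sym2 (Fin I.n))} {u v : Fin I.n} (h : s(v, u) ∈ J) :
    I.cost s(v, u) ≤ I.nodePower J v :=
  le_sup (f := I.cost) (mem_filter.2 ⟨h, Sym2.mem_mk_left v u⟩)

theorem mem_output {s : State} {u v : Fin I.n} : s(v, u) ∈ I.output s ↔
    s.arr 3 (v * I.n + u) ≠ 0 ∨ s.arr 3 (u * I.n + v) ≠ 0 := by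
  simp only [output, mem_image, mem_filter, mem_univ, true_and, Prod.exists, Sym2.eq_iff]
  constructor
  · rintro ⟨a, b, h, ⟨rfl, rfl⟩ | ⟨rfl, rfl⟩⟩
    · exact .inl h
    · exact .inr h
  · rintro (h | h)
    · exact ⟨v, u, h, .inl ⟨rfl, rfl⟩⟩
    · exact ⟨u, v, h, .inr ⟨rfl, rfl⟩⟩

variable {s : State} {J : Fin I.n → Fin I.n → Prop} {c : Fin I.n → Prop}

open scoped Classical in
theorem isCover_output (hP : I.costGraph.Progress J c fun _ _ => True)
    (hs : ∀ i j : Fin I.n, s.arr 3 (i * I.n + j) = 0 ↔ ¬ (J i j ∨ I.costGraph.Chosen c i j))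
    {K : Finset (Sym2 (Fin I.n))} (hK : I.IsCover K) : I.IsCover (I.output s) := by
  have hadj : ∀ i j, (J i j ∨ I.costGraph.Chosen c i j) → I.graph.Adj i j := fun i j h =>
    h.elim (hP.adj i j) And.left
  refine ⟨fun e => ?_, fun v => ?_⟩
  · induction e with | _ v u => ?_
    rw [mem_output, ne_eq, ne_eq, hs, hs, not_not, not_not]
    rintro (h | h)
    · exact hadj v u h
    · exact (hadj u v h).symm
  · refine (hP.isCover hK.feasible v).trans ?_
    refine card_le_card_of_injOn (fun u => s(v, u)) (fun u hu => ?_)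
      fun a _ b _ h => Sym2.congr_right.1 h
    refine mem_filter.2 ⟨mem_output.2 ?_, Sym2.mem_mk_left v u⟩
    rw [ne_eq, ne_eq, hs, hs, not_not, not_not]
    exact (mem_filter.1 hu).2

theorem power_output_le (hP : I.costGraph.Progress J c fun _ _ => True)
    (hs : ∀ i j : Fin I.n, s.arr 3 (i * I.n + j) = 0 ↔ ¬ (J i j ∨ I.costGraph.Chosen c i j))
    {K : Finset (Sym2 (Fin I.n))} (hK : I.IsCover K) :
    I.power (I.output s) ≤ ((I.maxReq : ℚ≥0) + 1 / 2) * I.power K := by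
  have hD : (0 : ℚ≥0) < I.scaleFactor := by exact_mod_cast scaleFactor_pos
  obtain ⟨b, hb, hsum⟩ := hP.exists_budget hK.feasible
    -- The budget argument needs natural powers. Scaled edge costs are natural, so they stay below
    -- the floor, and the floor only lowers the right-hand side.
    (P := fun v => ⌊I.scaleFactor * I.nodePower K v⌋₊) (k := I.maxReq)
    (fun v u h => Nat.le_floor (by
      rw [show I.costGraph.cost v u = I.scaledCost v u from rfl, cast_scaledCost (hK.1 _ h)]
      gcongr
      exact cost_le_nodePower h))
    (fun v => le_sup (f := I.req) (mem_univ v))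
  have hadj : ∀ i j, (J i j ∨ I.costGraph.Chosen c i j) → I.graph.Adj i j := fun i j h =>
    h.elim (hP.adj i j) And.left
  have hnode : ∀ v, I.scaleFactor * I.nodePower (I.output s) v ≤ b v := by
    intro v
    rw [← le_div_iff₀' hD]
    refine Finset.sup_le fun e he => ?_
    obtain ⟨he, u, rfl⟩ := mem_filter.1 he
    rw [le_div_iff₀' hD]
    rw [mem_output, ne_eq, ne_eq, hs, hs, not_not, not_not] at he
    rcases he with h | h
    · rw [← cast_scaledCost (hadj v u h)]
      exact_mod_cast (hb v u h).1
    · rw [Sym2.eq_swap, ← cast_scaledCost (hadj u v h)]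
      exact_mod_cast (hb u v h).2
  have h₁ : I.scaleFactor * I.power (I.output s) ≤ ∑ v, (b v : ℚ≥0) := by
    rw [power, mul_sum]
    exact sum_le_sum fun v _ => hnode v
  have h₂ : (∑ v, (⌊I.scaleFactor * I.nodePower K v⌋₊ : ℚ≥0)) ≤ I.scaleFactor * I.power K := by
    rw [power, mul_sum]
    exact sum_le_sum fun v _ => Nat.floor_le zero_le
  have h₃ : (2 : ℚ≥0) * ∑ v, (b v : ℚ≥0) ≤
      (2 * I.maxReq + 1) * ∑ v, (⌊I.scaleFactor * I.nodePower K v⌋₊ : ℚ≥0) := by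
    exact_mod_cast hsum
  refine le_of_mul_le_mul_left ?_ (mul_pos two_pos hD)
  calc 2 * (I.scaleFactor : ℚ≥0) * I.power (I.output s)
      = 2 * (I.scaleFactor * I.power (I.output s)) := by ring
    _ ≤ 2 * ∑ v, (b v : ℚ≥0) := by gcongr
    _ ≤ (2 * I.maxReq + 1) * ∑ v, (⌊I.scaleFactor * I.nodePower K v⌋₊ : ℚ≥0) := h₃
    _ ≤ (2 * I.maxReq + 1) * (I.scaleFactor * I.power K) := by gcongr
    _ = 2 * I.scaleFactor * ((I.maxReq + 1 / 2) * I.power K) := by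
      rw [show (2 * I.maxReq + 1 : ℚ≥0) = 2 * (I.maxReq + 1 / 2) by rw [mul_add]; norm_num]
      ring

end MPEMC

theorem theorem2 :
    ∃ (P : RAM.Program) (p : Polynomial ℕ), ∀ I : MPEMC,
      ∃ (s : RAM.State) (t : ℕ), RAM.Exec P I.input s t ∧ t ≤ p.eval I.size ∧
        ((∃ J, I.IsCover J) →
          I.IsCover (I.output s) ∧
            ∀ J, I.IsCover J →
              I.power (I.output s) ≤ ((I.maxReq : ℚ≥0) + 1 / 2) * I.power J) := by
  refine ⟨MPEMC.program, MPEMC.program.cost, fun I => ?_⟩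
  obtain ⟨s, t, hexec, ht, J, c, hP, hs⟩ := MPEMC.runs_program I
  exact ⟨s, t, hexec, ht, fun ⟨K, hK⟩ =>
    ⟨MPEMC.isCover_output hP hs hK, fun K' hK' => MPEMC.power_output_le hP hs hK'⟩⟩
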